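/- For an $r\times n$ real matrix $M'$ and $\delta>0$, say that $M'$ is \emph{$\delta$-non-degenerate} if for every unit vector $e\in\mathbb{R}^r$ (in the Euclidean norm) there are at least $\delta n$ columns $w$ of $M'$ (counted with multiplicity) satisfying $|\langle w,e\rangle|\ge\delta$. For every integer $r\ge 3$ and every $\delta>0$ there is a constant $C=C(r,\delta)>0$ such that the following holds. Let $n\ge 1$ and consider a real quadratic polynomial \[ f(x)=\sum_{1\le i\le j\le n}a_{ij}x_ix_j+\sum_{1\le i\le n}a_ix_i+a_0, \] let $a_{ji}=a_{ij}$ for $i<j$, and let $M=(a_{ij})_{i,j}\in\mathbb{R}^{n\times n}$. Suppose that $|a_{ij}|\le 1$ for all $i,j\in\{1,\dots,n\}$, and suppose that there is a set $T\subseteq\{1,\dots,n\}^r$ of at least $\delta n$ $r$-tuples, no two of which share an index, such that for each $(i_1,\dots,i_r)\in T$ the $r\times n$ matrix whose rows are the rows $i_1,\dots,i_r$ of $M$ is $\delta$-non-degenerate. Let $\xi=(\xi_1,\dots,\xi_n)$ be a sequence of independent Rademacher random variables, i.e. $\Pr(\xi_i=1)=\Pr(\xi_i=-1)=1/2$. Then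 for every $x\in\mathbb{R}$, \[ \Pr\left(|f(\xi)-x|\le n^{2/(r+2)}\right)\le C\cdot\frac{(\log n)^{r/2}}{n^{1-2/(r+2)}}, \] where $\log$ is the natural logarithm. -/

import Mathlib

open MeasureTheory ProbabilityTheory
open scoped ENNReal

/-- The Rademacher distribution: the values `1` and `-1` have probability `1/2` each. -/
noncomputable def rademacher : Measure ℝ :=
  (1 / 2 : ℝ≥0∞) • Measure.dirac 1 + (1 / 2 : ℝ≥0∞) • Measure.dirac (-1)

/-- `ξ = (ξ₁, …, ξₙ)` is a sequence of independent Rademacher random variables. -/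
structure IsRademacherVector {Ω : Type*} [MeasurableSpace Ω] {n : ℕ}
    (ξ : Fin n → Ω → ℝ) (μ : Measure Ω) : Prop where
  hasLaw : ∀ i, HasLaw (ξ i) rademacher μ
  indep : iIndepFun ξ μ

/-- The value at `x` of the polynomial
`∑_{i ≤ j} a i j * x i * x j + ∑ i, b i * x i + c`.
Only the entries `a i j` with `i ≤ j` are used. -/
def quadraticPoly {n : ℕ} (a : Fin n → Fin n → ℝ) (b : Fin n → ℝ) (c : ℝ)
    (x : Fin n → ℝ) : ℝ :=
  (∑ i, ∑ j ∈ Finset.Ici i, a i j * x i * x j) + (∑ i, b i * x i) + c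

/-- The symmetric matrix whose `(i, j)` entry is `a i j` for `i ≤ j` and `a j i` for `i > j`. -/
def coeffMatrix {n : ℕ} (a : Fin n → Fin n → ℝ) : Matrix (Fin n) (Fin n) ℝ :=
  Matrix.of fun i j => if i ≤ j then a i j else a j i

/-- An `r × n` matrix is `δ`-non-degenerate if for every (Euclidean) unit vector `e ∈ ℝʳ` there
are at least `δ n` columns `w` with `|⟨w, e⟩| ≥ δ` (columns are counted by their index). -/
def IsNonDegenerate {r n : ℕ} (δ : ℝ) (M : Matrix (Fin r) (Fin n) ℝ) : Prop :=
  ∀ e : EuclideanSpace ℝ (Fin r), ‖e‖ = 1 →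
    δ * n ≤ ((Finset.univ.filter fun j : Fin n =>
      δ ≤ |inner ℝ (WithLp.toLp 2 (M.col j)) e|).card : ℝ)

/-!
By Esseen's inequality, the mass of an interval of radius `s` is controlled by
`s * ∫ t in 0..s⁻¹, ‖φ t‖`, where `φ` is the characteristic function of the polynomial. Choose `2h`
of the given tuples, with `h` proportional to `n`, and let `U` be the set of their indices.
Decoupling the variables in `U` from the others and applying AM-GM over the tuples bounds
`‖φ τ‖ ^ 2` by an average over single tuples of `∏ k, cos (τ * ⟨M (t k), y - y'⟩) ^ (2 * h)`.
Expanding these powers into characters turns the average over `y` and `y'` into a sum over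
`V ∈ ℤ ^ r` of binomial weights, which are spread at scale `√h`, times
`∏ j, cos (2 * τ * ⟨V, w j⟩) ^ 2`, where `w j` are the columns of the rows picked by the tuple. If
two points in a box of side of order `1 / τ` both make this product large, then so does their
difference, and non-degeneracy forces that difference to be of order `1 / (√n * τ)`. Summing over
the boxes gives `‖φ τ‖ ^ 2 ≤ (K * (1 / (n * τ) + τ)) ^ r`, where `K` depends on `r` and `δ` only.
The exponent `r / 2` exceeds `1`, so the integral of `(1 / (n * t) + t) ^ (r / 2)` loses no
logarithm: the part `t < 1 / n` is trivial, and what remains is of order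
`1 / n + s⁻¹ ^ (r / 2 + 1)`.
-/

section Esseen

open Real

lemma sq_mul_integral_one_sub_mul_cos (y : ℝ) :
    y ^ 2 * ∫ t in (0 : ℝ)..1, (1 - t) * cos (t * y) = 1 - cos y := by
  have hderiv : ∀ t ∈ Set.uIcc (0 : ℝ) 1,
      HasDerivAt (fun t => y * (1 - t) * sin (t * y) - cos (t * y))
        (y ^ 2 * ((1 - t) * cos (t * y))) t := by
    intro t _
    have hty : HasDerivAt (fun t => t * y) y t := hasDerivAt_mul_const y
    refine (((((hasDerivAt_id' t).const_sub 1).const_mul y).mul hty.sin).sub hty.cos).congr_deriv ?_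
    ring
  rw [← intervalIntegral.integral_const_mul,
    intervalIntegral.integral_eq_sub_of_hasDerivAt hderiv
      (Continuous.intervalIntegrable (by fun_prop) 0 1)]
  norm_num
  ring

lemma integral_one_sub_mul_cos_nonneg (y : ℝ) :
    0 ≤ ∫ t in (0 : ℝ)..1, (1 - t) * cos (t * y) := by
  rcases eq_or_ne y 0 with rfl | hy
  · exact intervalIntegral.integral_nonneg zero_le_one fun t ht => by simp [ht.2]
  · refine nonneg_of_mul_nonneg_right ?_ (sq_pos_of_ne_zero hy)
    rw [sq_mul_integral_one_sub_mul_cos]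
    linarith [cos_le_one y]

lemma one_div_four_le_integral_one_sub_mul_cos {y : ℝ} (hy : |y| ≤ 1) :
    1 / 4 ≤ ∫ t in (0 : ℝ)..1, (1 - t) * cos (t * y) := by
  have hcos : ∀ t ∈ Set.Icc (0 : ℝ) 1, (1 - t) * (1 / 2) ≤ (1 - t) * cos (t * y) := by
    intro t ht
    have hty : (t * y) ^ 2 ≤ 1 := by
      rw [sq_le_one_iff_abs_le_one, abs_mul, abs_of_nonneg ht.1]
      exact mul_le_one₀ ht.2 (abs_nonneg y) hy
    exact mul_le_mul_of_nonneg_left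
      (by linarith [one_sub_sq_div_two_le_cos (x := t * y)]) (by linarith [ht.2])
  calc (1 / 4 : ℝ) = ∫ t in (0 : ℝ)..1, (1 - t) * (1 / 2) := by
        rw [intervalIntegral.integral_mul_const, intervalIntegral.integral_sub (by simp) (by simp)]
        norm_num
    _ ≤ _ := intervalIntegral.integral_mono_on zero_le_one
        (Continuous.intervalIntegrable (by fun_prop) 0 1)
        (Continuous.intervalIntegrable (by fun_prop) 0 1) hcos

variable (μ : Measure ℝ) [IsFiniteMeasure μ]

lemma integrable_one_sub_mul_cos :
    Integrable (Function.uncurry fun t y : ℝ => (1 - t) * cos (t * y))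
      ((volume.restrict (Set.Ioc 0 1)).prod μ) := by
  have hfst : Integrable (fun t : ℝ => 1 - t) (volume.restrict (Set.Ioc 0 1)) :=
    (Continuous.integrableOn_Icc (by fun_prop)).mono_set Set.Ioc_subset_Icc_self
  refine (hfst.comp_fst μ).mono (Continuous.aestronglyMeasurable (by fun_prop)) ?_
  refine .of_forall fun p => ?_
  simpa [Function.uncurry] using
    mul_le_of_le_one_right (abs_nonneg (1 - p.1)) (abs_cos_le_one (p.1 * p.2))

lemma integral_integral_one_sub_mul_cos :
    ∫ y, (∫ t in (0 : ℝ)..1, (1 - t) * cos (t * y)) ∂μ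
      = ∫ t in (0 : ℝ)..1, (1 - t) * (charFun μ t).re := by
  rw [← intervalIntegral_integral_swap
    (by simpa only [Set.uIoc_of_le zero_le_one] using integrable_one_sub_mul_cos μ)]
  refine intervalIntegral.integral_congr fun t _ => ?_
  have hexp : Integrable (fun y : ℝ => Complex.exp (t * y * Complex.I)) μ :=
    .of_bound (by fun_prop) 1 (.of_forall fun y => by
      rw [← Complex.ofReal_mul, Complex.norm_exp_ofReal_mul_I])
  simp only [integral_const_mul]
  rw [charFun_apply_real]
  congr 1
  refine Eq.trans ?_ (integral_re hexp)
  congr 1 with y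
  rw [← Complex.ofReal_mul]
  exact (Complex.exp_ofReal_mul_I_re _).symm

lemma measureReal_abs_le_one_le :
    μ.real {y | |y| ≤ 1} ≤ 4 * ∫ t in (0 : ℝ)..1, ‖charFun μ t‖ := by
  let K : ℝ → ℝ := fun y => ∫ t in (0 : ℝ)..1, (1 - t) * cos (t * y)
  have hK : Integrable K μ := by
    simpa only [K, intervalIntegral.integral_of_le zero_le_one, Function.uncurry]
      using (integrable_one_sub_mul_cos μ).integral_prod_right
  have hmarkov : 1 / 4 * μ.real {y | |y| ≤ 1} ≤ ∫ y, K y ∂μ :=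
    calc 1 / 4 * μ.real {y | |y| ≤ 1}
      _ ≤ 1 / 4 * μ.real {y | 1 / 4 ≤ K y} := by
          refine mul_le_mul_of_nonneg_left (measureReal_mono ?_) (by norm_num)
          exact fun y hy => one_div_four_le_integral_one_sub_mul_cos hy
      _ ≤ ∫ y, K y ∂μ := mul_meas_ge_le_integral_of_nonneg
          (.of_forall integral_one_sub_mul_cos_nonneg) hK _
  have hre : ∀ t ∈ Set.Icc (0 : ℝ) 1, (1 - t) * (charFun μ t).re ≤ ‖charFun μ t‖ := by
    intro t ht
    nlinarith [ht.1, ht.2, Complex.re_le_norm (charFun μ t), norm_nonneg (charFun μ t)]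
  have hchar : ∫ y, K y ∂μ ≤ ∫ t in (0 : ℝ)..1, ‖charFun μ t‖ := by
    rw [integral_integral_one_sub_mul_cos]
    have hint : IntervalIntegrable (fun t => (charFun μ t).re) volume 0 1 := by
      rw [intervalIntegrable_iff]
      exact (intervalIntegrable_iff.1 intervalIntegrable_charFun).re
    exact intervalIntegral.integral_mono_on zero_le_one (hint.continuousOn_mul (by fun_prop))
      intervalIntegrable_charFun.norm hre
  linarith

lemma measureReal_abs_sub_le_le (x : ℝ) {s : ℝ} (hs : 0 < s) :
    μ.real {y | |y - x| ≤ s} ≤ 4 * (s * ∫ t in (0 : ℝ)..s⁻¹, ‖charFun μ t‖) := by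
  let ν := (μ.map (· + -x)).map (s⁻¹ * ·)
  have hν : ν.real {y | |y| ≤ 1} = μ.real {y | |y - x| ≤ s} := by
    have hmeas : MeasurableSet {y : ℝ | |y| ≤ 1} :=
      measurableSet_le (by fun_prop) measurable_const
    rw [map_measureReal_apply (by fun_prop) hmeas,
      map_measureReal_apply (by fun_prop) (hmeas.preimage (by fun_prop))]
    congr 1 with y
    simp [abs_mul, abs_of_pos hs, inv_mul_le_one₀ hs, sub_eq_add_neg]
  have hchar : ∀ t, ‖charFun ν t‖ = ‖charFun μ (s⁻¹ * t)‖ := by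
    intro t
    rw [charFun_map_mul, charFun_map_add_const, norm_mul, Complex.norm_exp_ofReal_mul_I, mul_one]
  calc μ.real {y | |y - x| ≤ s}
    _ = ν.real {y | |y| ≤ 1} := hν.symm
    _ ≤ 4 * ∫ t in (0 : ℝ)..1, ‖charFun ν t‖ := measureReal_abs_le_one_le ν
    _ = 4 * (s * ∫ t in (0 : ℝ)..s⁻¹, ‖charFun μ t‖) := by
        simp_rw [hchar]
        rw [intervalIntegral.integral_comp_mul_left (fun t => ‖charFun μ t‖) (inv_ne_zero hs.ne')]
        simp

end Esseen

section CharFunDecay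

variable {p N s C : ℝ}

lemma intervalIntegrable_one_add_mul_rpow_neg (hN : 0 < N) (hs : 0 ≤ s) :
    IntervalIntegrable (fun t => (1 + N * t) ^ (-p)) volume 0 s := by
  refine ContinuousOn.intervalIntegrable (.rpow_const (by fun_prop) fun t ht => .inl ?_)
  rw [Set.uIcc_of_le hs] at ht
  have := mul_nonneg hN.le ht.1
  positivity

lemma integral_one_add_mul_rpow_neg_le (hp : 1 < p) (hN : 0 < N) (hs : 0 ≤ s) :
    ∫ t in (0 : ℝ)..s, (1 + N * t) ^ (-p) ≤ 1 / (N * (p - 1)) := by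
  have hzero : (0 : ℝ) ∉ Set.uIcc (1 + N * 0) (1 + N * s) := by
    rw [Set.uIcc_of_le (by gcongr)]
    exact fun h => by linarith [h.1]
  rw [intervalIntegral.integral_comp_add_mul (fun t => t ^ (-p)) hN.ne',
    integral_rpow (.inr ⟨by linarith, hzero⟩)]
  have : 0 < p - 1 := by linarith
  have hsN : 0 ≤ (1 + N * s) ^ (-p + 1) := by positivity
  have hpneg : -p + 1 = -(p - 1) := by ring
  rw [mul_zero, add_zero, Real.one_rpow, smul_eq_mul, hpneg, div_neg, ← neg_div, neg_sub,
    one_div, mul_inv, div_eq_mul_inv]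
  rw [hpneg] at hsN
  gcongr
  exact mul_le_of_le_one_left (by positivity) (by linarith)

lemma le_two_mul_inv_one_add_rpow {t u : ℝ} (hp : 0 ≤ p) (hN : 0 < N) (hC : 1 ≤ C) (ht : 0 < t)
    (hu : u ≤ 1) (hut : u ≤ (C * (1 / (N * t) + t)) ^ p) :
    u ≤ (2 * C * ((1 + N * t)⁻¹ + t)) ^ p := by
  have hNt : 0 < N * t := by positivity
  rcases lt_or_ge (N * t) 1 with hlt | hge
  · refine hu.trans (Real.one_le_rpow ?_ hp)
    have hhalf : 1 ≤ 2 * (1 + N * t)⁻¹ := by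
      rw [← div_eq_mul_inv, one_le_div (by positivity)]
      linarith
    nlinarith
  · refine hut.trans (Real.rpow_le_rpow (by positivity) ?_ hp)
    have hinv : 1 / (N * t) ≤ 2 * (1 + N * t)⁻¹ := by
      rw [← div_eq_mul_inv, div_le_div_iff₀ hNt (by positivity)]
      linarith
    nlinarith

lemma add_rpow_le_two_rpow_mul {u v : ℝ} (hu : 0 ≤ u) (hv : 0 ≤ v) (hp : 0 ≤ p) :
    (u + v) ^ p ≤ 2 ^ p * (u ^ p + v ^ p) := by
  have hmax : u + v ≤ 2 * max u v := by linarith [le_max_left u v, le_max_right u v]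
  calc (u + v) ^ p
    _ ≤ (2 * max u v) ^ p := Real.rpow_le_rpow (by positivity) hmax hp
    _ = 2 ^ p * max u v ^ p := Real.mul_rpow zero_le_two (le_max_of_le_left hu)
    _ ≤ 2 ^ p * (u ^ p + v ^ p) := by
        gcongr
        rcases max_choice u v with h | h <;> rw [h]
        · exact le_add_of_nonneg_right (by positivity)
        · exact le_add_of_nonneg_left (by positivity)

lemma le_rpow_mul_one_add_rpow_neg_add {t u : ℝ} (hp : 0 ≤ p) (hN : 0 < N) (hC : 1 ≤ C)
    (ht : 0 < t) (hu : u ≤ 1) (hut : u ≤ (C * (1 / (N * t) + t)) ^ p) :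
    u ≤ (4 * C) ^ p * ((1 + N * t) ^ (-p) + t ^ p) := by
  have hNt : 0 < 1 + N * t := by positivity
  calc u
    _ ≤ (2 * C * ((1 + N * t)⁻¹ + t)) ^ p := le_two_mul_inv_one_add_rpow hp hN hC ht hu hut
    _ ≤ (2 * C) ^ p * (2 ^ p * ((1 + N * t)⁻¹ ^ p + t ^ p)) := by
        rw [Real.mul_rpow (by positivity) (by positivity)]
        gcongr
        exact add_rpow_le_two_rpow_mul (by positivity) ht.le hp
    _ = (4 * C) ^ p * ((1 + N * t) ^ (-p) + t ^ p) := by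
        rw [Real.inv_rpow hNt.le, ← Real.rpow_neg hNt.le, ← mul_assoc,
          ← Real.mul_rpow (by positivity) zero_le_two]
        ring_nf

lemma measureReal_abs_sub_le_le_of_norm_charFun_le (μ : Measure ℝ) [IsProbabilityMeasure μ]
    (hp : 1 < p) (hN : 0 < N) (hC : 1 ≤ C)
    (hφ : ∀ t, 0 < t → ‖charFun μ t‖ ≤ (C * (1 / (N * t) + t)) ^ p) (x : ℝ) (hs : 0 < s) :
    μ.real {y | |y - x| ≤ s}
      ≤ 4 * (4 * C) ^ p * (1 / (p - 1) + 1) * (s / N + s ^ (-p)) := by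
  have hp0 : 0 ≤ p := by linarith
  have hp1 : 0 < p - 1 := by linarith
  have hpointwise : ∀ t ∈ Set.Ioo 0 s⁻¹,
      ‖charFun μ t‖ ≤ (4 * C) ^ p * ((1 + N * t) ^ (-p) + s ^ (-p)) := by
    rintro t ⟨ht, hts⟩
    refine (le_rpow_mul_one_add_rpow_neg_add hp0 hN hC ht (norm_charFun_le_one t)
      (hφ t ht)).trans ?_
    rw [Real.rpow_neg hs.le, ← Real.inv_rpow hs.le]
    gcongr
  have hint := intervalIntegrable_one_add_mul_rpow_neg (p := p) hN (inv_nonneg.2 hs.le)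
  calc μ.real {y | |y - x| ≤ s}
    _ ≤ 4 * (s * ∫ t in (0 : ℝ)..s⁻¹, ‖charFun μ t‖) := measureReal_abs_sub_le_le μ x hs
    _ ≤ 4 * (s * ∫ t in (0 : ℝ)..s⁻¹, (4 * C) ^ p * ((1 + N * t) ^ (-p) + s ^ (-p))) := by
        gcongr
        exact intervalIntegral.integral_mono_on_of_le_Ioo (inv_nonneg.2 hs.le)
          intervalIntegrable_charFun.norm ((hint.add (by simp)).const_mul _) hpointwise
    _ = 4 * (4 * C) ^ p * (s * (∫ t in (0 : ℝ)..s⁻¹, (1 + N * t) ^ (-p)) + s ^ (-p)) := by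
        rw [intervalIntegral.integral_const_mul, intervalIntegral.integral_add hint (by simp)]
        simp only [intervalIntegral.integral_const, sub_zero, smul_eq_mul]
        field_simp
    _ ≤ 4 * (4 * C) ^ p * (s * (1 / (N * (p - 1))) + s ^ (-p)) := by
        gcongr
        exact integral_one_add_mul_rpow_neg_le hp hN (inv_nonneg.2 hs.le)
    _ ≤ 4 * (4 * C) ^ p * ((1 / (p - 1) + 1) * (s / N + s ^ (-p))) := by
        have hcross : 0 ≤ s / N + 1 / (p - 1) * s ^ (-p) := by positivity
        gcongr
        have hsplit : s * (1 / (N * (p - 1))) = 1 / (p - 1) * (s / N) := by field_simp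
        rw [hsplit]
        linarith
    _ = _ := by ring

end CharFunDecay

section SignAverages

open scoped BigOperators

/-- The sign `±1` encoded by a Boolean; averages over `ι → Bool` are averages over sign vectors. -/
def boolSign (b : Bool) : ℝ := if b then 1 else -1

variable {ι I J : Type*}

lemma expect_pi_prod {𝕜 : Type*} [Field 𝕜] [CharZero 𝕜] [Fintype ι] [DecidableEq ι] {κ : Type*}
    [Fintype κ] (f : ι → κ → 𝕜) :
    𝔼 z : ι → κ, ∏ i, f i (z i) = ∏ i, 𝔼 b, f i b := by
  simp only [Fintype.expect_eq_sum_div_card, Finset.prod_div_distrib, Finset.prod_univ_sum,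
    Fintype.piFinset_univ, Fintype.card_fun, Finset.prod_const, Finset.card_univ, Nat.cast_pow]

lemma expect_cexp_boolSign_mul (θ : ℝ) :
    𝔼 b, Complex.exp ((boolSign b * θ : ℝ) * Complex.I) = (Real.cos θ : ℂ) := by
  rw [Fintype.expect_eq_sum_div_card]
  simp [boolSign, Complex.cos]

lemma expect_cexp_sum_boolSign_mul [Fintype ι] [DecidableEq ι] (θ : ι → ℝ) :
    𝔼 z : ι → Bool, Complex.exp ((∑ i, boolSign (z i) * θ i : ℝ) * Complex.I)
      = ((∏ i, Real.cos (θ i) : ℝ) : ℂ) := by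
  simp only [Complex.ofReal_sum, Finset.sum_mul, Complex.exp_sum, Complex.ofReal_prod,
    ← expect_cexp_boolSign_mul]
  exact expect_pi_prod fun i b => Complex.exp ((boolSign b * θ i : ℝ) * Complex.I)

lemma expect_expect_cexp_sum_mul_sub [Fintype J] [DecidableEq J] (θ : J → ℝ) :
    𝔼 y : J → Bool, 𝔼 y' : J → Bool,
        Complex.exp ((∑ j, θ j * (boolSign (y j) - boolSign (y' j)) : ℝ) * Complex.I)
      = ((∏ j, Real.cos (θ j) ^ 2 : ℝ) : ℂ) := by
  have hsplit : ∀ y y' : J → Bool,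
      Complex.exp ((∑ j, θ j * (boolSign (y j) - boolSign (y' j)) : ℝ) * Complex.I)
        = Complex.exp ((∑ j, boolSign (y j) * θ j : ℝ) * Complex.I)
          * Complex.exp ((∑ j, boolSign (y' j) * -θ j : ℝ) * Complex.I) := by
    intro y y'
    rw [← Complex.exp_add, ← add_mul, ← Complex.ofReal_add, ← Finset.sum_add_distrib]
    congr 4 with j
    ring
  simp only [hsplit, ← Finset.mul_expect, ← Finset.expect_mul, expect_cexp_sum_boolSign_mul,
    Real.cos_neg, ← Complex.ofReal_mul, ← Finset.prod_mul_distrib, sq]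

lemma sq_norm_expect_le [Fintype ι] [Nonempty ι] (f : ι → ℂ) :
    ‖𝔼 i, f i‖ ^ 2 ≤ 𝔼 i, ‖f i‖ ^ 2 := by
  calc ‖𝔼 i, f i‖ ^ 2
    _ ≤ (𝔼 i, ‖f i‖) ^ 2 := by
        gcongr
        exact RCLike.norm_expect_le (K := ℂ)
    _ ≤ 𝔼 i, ‖f i‖ ^ 2 := by
        simpa using Finset.expect_mul_sq_le_sq_mul_sq Finset.univ (fun i => ‖f i‖) 1

lemma ofReal_sq_norm_expect [Fintype ι] (f : ι → ℂ) :
    ((‖𝔼 i, f i‖ ^ 2 : ℝ) : ℂ) = 𝔼 i, 𝔼 j, f i * (starRingEnd ℂ) (f j) := by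
  rw [← Complex.normSq_eq_norm_sq, ← Complex.mul_conj, map_expect, Fintype.expect_mul_expect]

lemma expect_sq_norm_expect_cexp_eq [Fintype I] [Fintype J]
    [DecidableEq I] [DecidableEq J]
    (A : (I → Bool) → ℝ) (B : (J → Bool) → ℝ) (m : I → J → ℝ) :
    ((𝔼 z : I → Bool, ‖𝔼 y : J → Bool, Complex.exp
        ((A z + B y + ∑ i, boolSign (z i) * ∑ j, m i j * boolSign (y j) : ℝ)
          * Complex.I)‖ ^ 2 : ℝ) : ℂ)
      = 𝔼 y : J → Bool, 𝔼 y' : J → Bool, Complex.exp ((B y - B y' : ℝ) * Complex.I)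
          * ((∏ i, Real.cos (∑ j, m i j * (boolSign (y j) - boolSign (y' j))) : ℝ) : ℂ) := by
  have hterm : ∀ (z : I → Bool) (y y' : J → Bool),
      Complex.exp
          ((A z + B y + ∑ i, boolSign (z i) * ∑ j, m i j * boolSign (y j) : ℝ) * Complex.I)
        * (starRingEnd ℂ) (Complex.exp
          ((A z + B y' + ∑ i, boolSign (z i) * ∑ j, m i j * boolSign (y' j) : ℝ) * Complex.I))
      = Complex.exp ((B y - B y' : ℝ) * Complex.I) * Complex.exp
          ((∑ i, boolSign (z i) * ∑ j, m i j * (boolSign (y j) - boolSign (y' j)) : ℝ)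
            * Complex.I) := by
    intro z y y'
    rw [← Complex.exp_conj, map_mul, Complex.conj_ofReal, Complex.conj_I, ← Complex.exp_add,
      ← Complex.exp_add]
    simp only [mul_sub, Finset.sum_sub_distrib]
    push_cast
    ring_nf
  simp only [Complex.ofReal_expect, ofReal_sq_norm_expect, hterm]
  rw [Finset.expect_comm]
  refine Finset.expect_congr rfl fun y _ => ?_
  rw [Finset.expect_comm]
  simp only [← Finset.mul_expect, expect_cexp_sum_boolSign_mul]

/-- Decoupling of the two groups of signs in the phase: by Cauchy–Schwarz in `z`, the terms that
depend on `z` only or on `y` only have no influence. -/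
lemma sq_norm_expect_cexp_bilinear_le [Fintype I] [Fintype J]
    [DecidableEq I] [DecidableEq J]
    (A : (I → Bool) → ℝ) (B : (J → Bool) → ℝ) (m : I → J → ℝ) :
    ‖𝔼 z : I → Bool, 𝔼 y : J → Bool, Complex.exp
        ((A z + B y + ∑ i, boolSign (z i) * ∑ j, m i j * boolSign (y j) : ℝ) * Complex.I)‖ ^ 2
      ≤ 𝔼 y : J → Bool, 𝔼 y' : J → Bool,
          ∏ i, |Real.cos (∑ j, m i j * (boolSign (y j) - boolSign (y' j)))| := by
  refine (sq_norm_expect_le _).trans ((le_abs_self _).trans ?_)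
  rw [← Real.norm_eq_abs, ← Complex.norm_real, expect_sq_norm_expect_cexp_eq]
  refine RCLike.norm_expect_le (K := ℂ).trans (Finset.expect_le_expect fun y _ => ?_)
  refine RCLike.norm_expect_le (K := ℂ).trans (Finset.expect_le_expect fun y' _ => ?_)
  rw [norm_mul, Complex.norm_exp_ofReal_mul_I, one_mul, Complex.norm_real, norm_prod]
  simp only [Real.norm_eq_abs, le_refl]

end SignAverages

section RademacherLaw

open scoped BigOperators

lemma rademacher_eq_sum_dirac :
    rademacher = ∑ b : Bool, (2⁻¹ : ℝ≥0∞) • Measure.dirac (boolSign b) := by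
  simp [rademacher, boolSign]

instance : IsProbabilityMeasure rademacher where
  measure_univ := by simp [rademacher, ENNReal.inv_two_add_inv_two]

lemma pi_rademacher_eq_sum_dirac {ι : Type*} [Fintype ι] [DecidableEq ι] :
    Measure.pi (fun _ : ι => rademacher)
      = ∑ ε : ι → Bool, (2⁻¹ : ℝ≥0∞) ^ Fintype.card ι • Measure.dirac fun i => boolSign (ε i) := by
  classical
  refine Measure.pi_eq fun s hs => ?_
  simp only [rademacher_eq_sum_dirac, Measure.coe_finsetSum, Finset.sum_apply, Measure.smul_apply,
    smul_eq_mul, Finset.prod_univ_sum, Fintype.piFinset_univ]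
  refine Finset.sum_congr rfl fun ε _ => ?_
  rw [Finset.prod_mul_distrib, Finset.prod_const, Finset.card_univ,
    Measure.dirac_apply' _ (.univ_pi hs)]
  simp only [Measure.dirac_apply' _ (hs _), Set.indicator_apply, Pi.one_apply, Set.mem_univ_pi]
  rw [Fintype.prod_ite_zero, Finset.prod_const_one]

namespace IsRademacherVector

variable {Ω : Type*} [MeasurableSpace Ω] {μ : Measure Ω} {n : ℕ}
  {ξ : Fin n → Ω → ℝ}

lemma hasLaw_pi (hξ : IsRademacherVector ξ μ) :
    HasLaw (fun ω i => ξ i ω) (Measure.pi fun _ => rademacher) μ :=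
  hξ.indep.hasLaw_pi hξ.hasLaw

lemma integral_comp_eq_expect (hξ : IsRademacherVector ξ μ) {F : (Fin n → ℝ) → ℂ}
    (hF : Measurable F) :
    ∫ ω, F (fun i => ξ i ω) ∂μ = 𝔼 ε : Fin n → Bool, F fun i => boolSign (ε i) := by
  have hdirac : ∀ ε : Fin n → Bool, Integrable F
      ((2⁻¹ : ℝ≥0∞) ^ Fintype.card (Fin n) • Measure.dirac fun i => boolSign (ε i)) := fun ε =>
    (integrable_dirac (by simp)).smul_measure (by simp)
  calc ∫ ω, F (fun i => ξ i ω) ∂μ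
    _ = ∫ x, F x ∂Measure.pi fun _ => rademacher :=
        hξ.hasLaw_pi.integral_comp (f := F) hF.aestronglyMeasurable
    _ = 𝔼 ε : Fin n → Bool, F fun i => boolSign (ε i) := by
        rw [pi_rademacher_eq_sum_dirac, integral_finsetSum_measure fun ε _ => hdirac ε,
          Fintype.expect_eq_sum_div_card, Finset.sum_div]
        simp [integral_smul_measure, integral_dirac' _ _ hF.stronglyMeasurable,
          div_eq_inv_mul]

lemma charFun_map_eq_expect (hξ : IsRademacherVector ξ μ) {f : (Fin n → ℝ) → ℝ}
    (hf : Measurable f) (t : ℝ) :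
    charFun (μ.map fun ω => f fun i => ξ i ω) t
      = 𝔼 ε : Fin n → Bool, Complex.exp ((t * f fun i => boolSign (ε i) : ℝ) * Complex.I) := by
  have hmeas : AEMeasurable (fun ω => f fun i => ξ i ω) μ :=
    hf.comp_aemeasurable hξ.hasLaw_pi.aemeasurable
  rw [charFun_apply_real, integral_map hmeas (by fun_prop)]
  simp only [Complex.ofReal_mul]
  exact hξ.integral_comp_eq_expect (F := fun x => Complex.exp (t * f x * Complex.I)) (by fun_prop)

end IsRademacherVector

end RademacherLaw

section BinomialWeights

open scoped BigOperators

/-- The symmetric binomial distribution: `binomWeight h |v|` is the probability that a sum of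
`2 * h` independent signs equals `2 * v`. -/
noncomputable def binomWeight (h u : ℕ) : ℝ := ((2 * h).choose (h + u) : ℝ) / 4 ^ h

lemma binomWeight_nonneg (h u : ℕ) : 0 ≤ binomWeight h u := by
  unfold binomWeight
  positivity

lemma binomWeight_antitone (h : ℕ) : Antitone (binomWeight h) := by
  refine antitone_nat_of_succ_le fun u => ?_
  have hrec := Nat.choose_succ_right_eq (2 * h) (h + u)
  have hle : (2 * h).choose (h + u + 1) * (h + u + 1) ≤ (2 * h).choose (h + u) * (h + u + 1) :=
    hrec.trans_le (Nat.mul_le_mul_left _ (by omega))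
  unfold binomWeight
  gcongr ((?_ : ℕ) : ℝ) / _
  exact Nat.le_of_mul_le_mul_right hle (by omega)

lemma sum_range_binomWeight_le_one (h N : ℕ) : ∑ u ∈ Finset.range N, binomWeight h u ≤ 1 := by
  have hnat : ∑ u ∈ Finset.range N, (2 * h).choose (h + u) ≤ 4 ^ h :=
    calc ∑ u ∈ Finset.range N, (2 * h).choose (h + u)
      _ = ∑ b ∈ (Finset.range N).map (addLeftEmbedding h), (2 * h).choose b := by simp
      _ ≤ ∑ b ∈ Finset.range (2 * h + 1), (2 * h).choose b := by
          refine Finset.sum_le_sum_of_ne_zero fun b _ hb => Finset.mem_range.2 ?_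
          by_contra hlt
          exact hb (Nat.choose_eq_zero_of_lt (by omega))
      _ = 4 ^ h := by
          rw [Nat.sum_range_choose, pow_mul]
          norm_num
  unfold binomWeight
  rw [← Finset.sum_div, div_le_one (by positivity)]
  exact_mod_cast hnat

lemma binomWeight_succ_zero (h : ℕ) :
    binomWeight (h + 1) 0 = (2 * h + 1) / (2 * h + 2) * binomWeight h 0 := by
  have hrec : ((h : ℝ) + 1) * (h + 1).centralBinom = 2 * (2 * h + 1) * h.centralBinom := by
    exact_mod_cast Nat.succ_mul_centralBinom_succ h
  simp only [binomWeight, add_zero, ← Nat.centralBinom_eq_two_mul_choose]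
  field_simp
  linear_combination 2 * 4 ^ h * hrec

lemma binomWeight_zero_le (h : ℕ) : binomWeight h 0 ≤ 1 / √(2 * h + 1) := by
  suffices hsq : binomWeight h 0 ^ 2 ≤ 1 / (2 * h + 1) by
    rw [one_div, ← Real.sqrt_inv, ← one_div]
    exact Real.le_sqrt_of_sq_le hsq
  induction h with
  | zero => simp [binomWeight]
  | succ h ih =>
    rw [binomWeight_succ_zero, mul_pow]
    push_cast
    calc ((2 * h + 1) / (2 * h + 2) : ℝ) ^ 2 * binomWeight h 0 ^ 2
      _ ≤ ((2 * h + 1) / (2 * h + 2) : ℝ) ^ 2 * (1 / (2 * h + 1)) := by gcongr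
      _ = (2 * h + 1) / (2 * h + 2) ^ 2 := by field_simp
      _ ≤ 1 / (2 * (h + 1) + 1) := by
          rw [div_le_div_iff₀ (by positivity) (by positivity)]
          nlinarith

lemma choose_eq_binomWeight_mul {h b : ℕ} (hb : b ≤ 2 * h) :
    ((2 * h).choose b : ℝ) = binomWeight h ((b : ℤ) - h).natAbs * 4 ^ h := by
  rw [binomWeight, div_mul_cancel₀ _ (by positivity)]
  rcases le_total h b with hhb | hbh
  · congr 2
    omega
  · rw [← Nat.choose_symm hb]
    congr 2
    omega

lemma cos_pow_eq_sum_binomWeight (h : ℕ) (θ : ℝ) :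
    ((Real.cos θ ^ (2 * h) : ℝ) : ℂ) = ∑ v ∈ Finset.Icc (-(h : ℤ)) h,
      (binomWeight h v.natAbs : ℂ) * Complex.exp ((v * (2 * θ) : ℝ) * Complex.I) := by
  have hbinom : ((Real.cos θ ^ (2 * h) : ℝ) : ℂ) = ∑ b ∈ Finset.range (2 * h + 1),
      (Complex.exp (θ * Complex.I) ^ b * Complex.exp (-θ * Complex.I) ^ (2 * h - b)
        * ((2 * h).choose b : ℝ)) / 4 ^ h := by
    simp only [Complex.ofReal_natCast]
    rw [← Finset.sum_div, ← add_pow, Complex.ofReal_pow, Complex.ofReal_cos, Complex.cos, div_pow,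
      pow_mul 2]
    norm_num
  rw [hbinom]
  refine Finset.sum_bij' (fun b _ => (b : ℤ) - h) (fun v _ => (v + h).toNat) ?_ ?_ ?_ ?_ ?_
  · grind
  · grind
  · grind
  · grind
  intro b hb
  have hb' : b ≤ 2 * h := by grind
  rw [choose_eq_binomWeight_mul hb', ← Complex.exp_nat_mul, ← Complex.exp_nat_mul,
    ← Complex.exp_add, Nat.cast_sub hb']
  push_cast
  field_simp
  ring_nf

/-- Moments of the decoupled cosines, found by expanding each power into characters. -/
lemma expect_expect_prod_cos_pow {K J : Type*} [Fintype K] [Fintype J] [DecidableEq K]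
    [DecidableEq J] (h : ℕ) (w : K → J → ℝ) :
    𝔼 y : J → Bool, 𝔼 y' : J → Bool,
        ∏ k, Real.cos (∑ j, w k j * (boolSign (y j) - boolSign (y' j))) ^ (2 * h)
      = ∑ V ∈ Fintype.piFinset fun _ : K => Finset.Icc (-(h : ℤ)) h,
          (∏ k, binomWeight h (V k).natAbs) * ∏ j, Real.cos (2 * ∑ k, V k * w k j) ^ 2 := by
  have hexpand : ∀ y y' : J → Bool,
      ((∏ k, Real.cos (∑ j, w k j * (boolSign (y j) - boolSign (y' j))) ^ (2 * h) : ℝ) : ℂ)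
      = ∑ V ∈ Fintype.piFinset fun _ : K => Finset.Icc (-(h : ℤ)) h,
          ((∏ k, binomWeight h (V k).natAbs : ℝ) : ℂ) * Complex.exp
            ((∑ j, (2 * ∑ k, V k * w k j) * (boolSign (y j) - boolSign (y' j)) : ℝ)
              * Complex.I) := by
    intro y y'
    rw [Complex.ofReal_prod, Finset.prod_congr rfl fun k _ => cos_pow_eq_sum_binomWeight h _,
      Finset.prod_univ_sum]
    refine Finset.sum_congr rfl fun V _ => ?_
    rw [Finset.prod_mul_distrib, Complex.ofReal_prod, ← Complex.exp_sum, ← Finset.sum_mul,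
      ← Complex.ofReal_sum]
    congr 4
    simp only [Finset.mul_sum, Finset.sum_mul]
    rw [Finset.sum_comm]
    exact Finset.sum_congr rfl fun j _ => Finset.sum_congr rfl fun k _ => by ring
  apply Complex.ofReal_injective
  simp only [Complex.ofReal_expect, hexpand, Finset.expect_sum_comm, ← Finset.mul_expect,
    expect_expect_cexp_sum_mul_sub]
  simp only [Complex.ofReal_sum, Complex.ofReal_mul]

end BinomialWeights

section BoxSums

lemma sum_multiples_le_of_antitone {g : ℕ → ℝ} (hg : Antitone g) (h0 : ∀ u, 0 ≤ g u) {ℓ : ℕ}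
    (hℓ : 0 < ℓ) (N : ℕ) :
    ∑ q ∈ Finset.range N, g (ℓ * q) ≤ g 0 + (∑ u ∈ Finset.range (ℓ * N), g u) / ℓ := by
  have hblock : ∀ q, g (ℓ * (q + 1)) ≤ (∑ i ∈ Finset.range ℓ, g (ℓ * q + i)) / ℓ := fun q => by
    rw [le_div_iff₀ (by exact_mod_cast hℓ), mul_comm, ← nsmul_eq_mul]
    nth_rw 1 [← Finset.card_range ℓ]
    refine Finset.card_nsmul_le_sum _ _ _ fun i hi => hg ?_
    rw [Finset.mem_range] at hi
    grind
  have hshift : ∑ q ∈ Finset.range N, g (ℓ * (q + 1))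
      ≤ (∑ u ∈ Finset.range (ℓ * N), g u) / ℓ := by
    induction N with
    | zero => simp
    | succ N ih =>
      rw [Finset.sum_range_succ, mul_add, mul_one, Finset.sum_range_add, add_div]
      exact add_le_add ih (hblock N)
  calc ∑ q ∈ Finset.range N, g (ℓ * q)
    _ ≤ ∑ q ∈ Finset.range (N + 1), g (ℓ * q) :=
        Finset.sum_le_sum_of_subset_of_nonneg (Finset.range_subset_range.2 N.le_succ)
          fun _ _ _ => h0 _
    _ = g 0 + ∑ q ∈ Finset.range N, g (ℓ * (q + 1)) := by
        rw [Finset.sum_range_succ', mul_zero, add_comm]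
    _ ≤ g 0 + (∑ u ∈ Finset.range (ℓ * N), g u) / ℓ := by gcongr

lemma sum_natAbs_sub_le {F : ℕ → ℝ} {B : ℝ} (hF : ∀ u, 0 ≤ F u)
    (hB : ∀ N, ∑ u ∈ Finset.range N, F u ≤ B) (S : Finset ℤ) (v₀ : ℤ) :
    ∑ v ∈ S, F (v - v₀).natAbs ≤ 2 * B := by
  have hhalf : ∀ S' : Finset ℤ, Set.InjOn (fun v => (v - v₀).natAbs) S' →
      ∑ v ∈ S', F (v - v₀).natAbs ≤ B := by
    intro S' hinj
    obtain ⟨N, hN⟩ := (S'.image fun v => (v - v₀).natAbs).exists_nat_subset_range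
    rw [← Finset.sum_image (f := F) hinj]
    exact (Finset.sum_le_sum_of_subset_of_nonneg hN fun u _ _ => hF u).trans (hB N)
  rw [← Finset.sum_filter_add_sum_filter_not S (v₀ ≤ ·), two_mul]
  refine add_le_add (hhalf _ fun v hv v' hv' hvv' => ?_) (hhalf _ fun v hv v' hv' hvv' => ?_) <;>
  · simp only [Finset.coe_filter, Set.mem_ofPred_eq] at hv hv' hvv'
    omega

lemma sum_range_exp_neg_mul_le {a : ℝ} (ha : 0 < a) (N : ℕ) :
    ∑ u ∈ Finset.range N, Real.exp (-(a * u)) ≤ 1 + 1 / a := by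
  have hlt : Real.exp (-a) < 1 := by simpa using ha
  have hle : Real.exp (-a) ≤ 1 / (1 + a) := by
    rw [Real.exp_neg, ← one_div]
    gcongr
    linarith [Real.add_one_le_exp a]
  calc ∑ u ∈ Finset.range N, Real.exp (-(a * u))
    _ = ∑ u ∈ Finset.range N, Real.exp (-a) ^ u := by
        refine Finset.sum_congr rfl fun u _ => ?_
        rw [← Real.exp_nat_mul]
        ring_nf
    _ ≤ (1 - Real.exp (-a))⁻¹ := by
        rw [← tsum_geometric_of_lt_one (Real.exp_pos _).le hlt]
        exact (summable_geometric_of_lt_one (Real.exp_pos _).le hlt).sum_le_tsum _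
          fun _ _ => by positivity
    _ ≤ (1 - 1 / (1 + a))⁻¹ := by
        have : 1 / (1 + a) < 1 := by rw [div_lt_one] <;> linarith
        gcongr
    _ = 1 + 1 / a := by
        rw [one_sub_div (by positivity), add_sub_cancel_left, inv_div, add_comm, add_div,
          div_self ha.ne']

lemma exp_neg_sq_le (x : ℝ) : Real.exp (-x ^ 2) ≤ 2 * Real.exp (-x) :=
  calc Real.exp (-x ^ 2)
    _ ≤ Real.exp (Real.log 2 + -x) :=
        Real.exp_le_exp.2 (by nlinarith [Real.log_two_gt_d9, sq_nonneg (x - 1 / 2)])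
    _ = 2 * Real.exp (-x) := by rw [Real.exp_add, Real.exp_log two_pos]

lemma sum_gaussian_le {a : ℝ} (ha : 0 < a) (S : Finset ℤ) (v₀ : ℤ) :
    ∑ v ∈ S, Real.exp (-(a ^ 2 * ((v - v₀ : ℤ) : ℝ) ^ 2)) ≤ 4 * (1 + 1 / a) := by
  have hexp : ∀ v : ℤ, Real.exp (-(a ^ 2 * ((v - v₀ : ℤ) : ℝ) ^ 2))
      ≤ 2 * Real.exp (-(a * (v - v₀).natAbs)) := fun v => by
    have h := exp_neg_sq_le (a * (v - v₀).natAbs)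
    rw [mul_pow, Nat.cast_natAbs, Int.cast_abs, sq_abs] at h
    rwa [Nat.cast_natAbs, Int.cast_abs]
  calc ∑ v ∈ S, Real.exp (-(a ^ 2 * ((v - v₀ : ℤ) : ℝ) ^ 2))
    _ ≤ 2 * ∑ v ∈ S, Real.exp (-(a * (v - v₀).natAbs)) := by
        rw [Finset.mul_sum]
        exact Finset.sum_le_sum fun v _ => hexp v
    _ ≤ 2 * (2 * (1 + 1 / a)) := by
        gcongr
        exact sum_natAbs_sub_le (F := fun u => Real.exp (-(a * u))) (fun _ => (Real.exp_pos _).le)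
          (sum_range_exp_neg_mul_le ha) S v₀
    _ = 4 * (1 + 1 / a) := by ring

lemma sin_sub_sq_le (a b : ℝ) :
    Real.sin (a - b) ^ 2 ≤ 2 * (Real.sin a ^ 2 + Real.sin b ^ 2) := by
  rw [Real.sin_sub]
  nlinarith [sq_nonneg (Real.sin a * Real.cos b + Real.cos a * Real.sin b),
    mul_nonneg (sq_nonneg (Real.sin a)) (sq_nonneg (Real.sin b)),
    Real.sin_sq_add_cos_sq a, Real.sin_sq_add_cos_sq b]

lemma sq_div_four_le_sin_sq {x : ℝ} (hx : |x| ≤ 1) : x ^ 2 / 4 ≤ Real.sin x ^ 2 := by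
  have hjordan := Real.mul_abs_le_abs_sin (x := x) (by linarith [Real.pi_gt_three])
  have hpi : (1 / 2 : ℝ) ≤ 2 / Real.pi := by
    rw [div_le_div_iff₀ (by norm_num) Real.pi_pos]
    linarith [Real.pi_le_four]
  have habs : |x / 2| ≤ |Real.sin x| := by
    rw [abs_div, abs_two]
    linarith [mul_le_mul_of_nonneg_right hpi (abs_nonneg x)]
  linarith [sq_le_sq.2 habs, div_pow x 2 2]

lemma prod_cos_sq_le_exp {J : Type*} [Fintype J] (θ : J → ℝ) :
    ∏ j, Real.cos (θ j) ^ 2 ≤ Real.exp (-∑ j, Real.sin (θ j) ^ 2) := by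
  rw [← Finset.sum_neg_distrib, Real.exp_sum]
  refine Finset.prod_le_prod (fun _ _ => sq_nonneg _) fun j _ => ?_
  rw [Real.cos_sq']
  linarith [Real.add_one_le_exp (-Real.sin (θ j) ^ 2)]

variable {K J : Type*} [Fintype K] [Fintype J]

/-- Quantitative independence of the rows of `w`: for every `V : K → ℝ`, the vector `wᵀ V` satisfies
`‖wᵀ V‖² ≥ σ ‖V‖²` in the Euclidean norms. -/
def RowCoercive (σ : ℝ) (w : K → J → ℝ) : Prop :=
  ∀ V : K → ℝ, σ * ∑ k, V k ^ 2 ≤ ∑ j, (∑ k, V k * w k j) ^ 2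

lemma RowCoercive.const_mul {σ : ℝ} {w : K → J → ℝ} (hσ : RowCoercive σ w) (τ : ℝ) :
    RowCoercive (τ ^ 2 * σ) fun k j => τ * w k j := fun V =>
  calc τ ^ 2 * σ * ∑ k, V k ^ 2
    _ ≤ τ ^ 2 * ∑ j, (∑ k, V k * w k j) ^ 2 := by
        rw [mul_assoc]
        exact mul_le_mul_of_nonneg_left (hσ V) (sq_nonneg τ)
    _ = ∑ j, (∑ k, V k * (τ * w k j)) ^ 2 := by
        simp only [Finset.mul_sum, ← mul_pow, mul_left_comm]

lemma RowCoercive.mul_sum_sq_le_sum_sin_sq {σ τ m : ℝ} {w : K → J → ℝ} (hσ : RowCoercive σ w)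
    (hw : ∀ k j, |w k j| ≤ τ) (hm : 2 * (Fintype.card K * (m * τ)) ≤ 1) {V : K → ℝ}
    (hV : ∀ k, |V k| ≤ m) :
    σ * ∑ k, V k ^ 2 ≤ ∑ j, Real.sin (2 * ∑ k, V k * w k j) ^ 2 := by
  have hsmall : ∀ j, |2 * ∑ k, V k * w k j| ≤ 1 := fun j =>
    calc |2 * ∑ k, V k * w k j|
      _ ≤ 2 * ∑ k, |V k * w k j| := by
          rw [abs_mul, abs_two]
          gcongr
          exact Finset.abs_sum_le_sum_abs _ _
      _ ≤ 2 * ∑ _k : K, m * τ := by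
          simp only [abs_mul]
          gcongr with k
          · exact (abs_nonneg _).trans (hV k)
          · exact hV k
          · exact hw k j
      _ = 2 * (Fintype.card K * (m * τ)) := by simp
      _ ≤ 1 := hm
  refine (hσ V).trans (Finset.sum_le_sum fun j _ => ?_)
  refine le_trans (le_of_eq ?_) (sq_div_four_le_sin_sq (hsmall j))
  ring

/-- A product of squared cosines decays in a Gaussian way from where it is largest. -/
lemma RowCoercive.exists_prod_cos_sq_le {σ τ m : ℝ} {w : K → J → ℝ} (hσ : RowCoercive σ w)
    (hw : ∀ k j, |w k j| ≤ τ) (hm : 2 * (Fintype.card K * (m * τ)) ≤ 1)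
    {D : Finset (K → ℤ)} (hne : D.Nonempty)
    (hD : ∀ V ∈ D, ∀ V' ∈ D, ∀ k, |((V k - V' k : ℤ) : ℝ)| ≤ m) :
    ∃ V₀ : K → ℤ, ∀ V ∈ D, ∏ j, Real.cos (2 * ∑ k, V k * w k j) ^ 2
      ≤ Real.exp (-(σ / 4 * ∑ k, ((V k - V₀ k : ℤ) : ℝ) ^ 2)) := by
  obtain ⟨V₀, hV₀, hmin⟩ :=
    D.exists_min_image (fun V => ∑ j, Real.sin (2 * ∑ k, V k * w k j) ^ 2) hne
  refine ⟨V₀, fun V hV => (prod_cos_sq_le_exp _).trans (Real.exp_le_exp.2 (neg_le_neg ?_))⟩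
  have hsub : ∀ j, 2 * ∑ k, ((V k - V₀ k : ℤ) : ℝ) * w k j
      = 2 * ∑ k, V k * w k j - 2 * ∑ k, V₀ k * w k j := fun j => by
    simp only [Int.cast_sub, sub_mul, Finset.sum_sub_distrib, mul_sub]
  have hcoercive := hσ.mul_sum_sq_le_sum_sin_sq hw hm (hD V hV V₀ hV₀)
  have hfour : ∑ j, Real.sin (2 * ∑ k, ((V k - V₀ k : ℤ) : ℝ) * w k j) ^ 2
      ≤ 4 * ∑ j, Real.sin (2 * ∑ k, V k * w k j) ^ 2 :=
    calc ∑ j, Real.sin (2 * ∑ k, ((V k - V₀ k : ℤ) : ℝ) * w k j) ^ 2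
      _ ≤ 2 * (∑ j, Real.sin (2 * ∑ k, V k * w k j) ^ 2
            + ∑ j, Real.sin (2 * ∑ k, V₀ k * w k j) ^ 2) := by
          rw [← Finset.sum_add_distrib, Finset.mul_sum]
          exact Finset.sum_le_sum fun j _ => hsub j ▸ sin_sub_sq_le _ _
      _ ≤ 4 * ∑ j, Real.sin (2 * ∑ k, V k * w k j) ^ 2 := by linarith [hmin V hV]
  linarith

variable [DecidableEq K]

lemma RowCoercive.sum_box_prod_cos_sq_le {σ τ m : ℝ} {w : K → J → ℝ} (hσ : RowCoercive σ w)
    (hσ0 : 0 < σ) (hw : ∀ k j, |w k j| ≤ τ)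
    (hm : 2 * (Fintype.card K * (m * τ)) ≤ 1) {S : K → Finset ℤ} {D : Finset (K → ℤ)}
    (hDS : D ⊆ Fintype.piFinset S)
    (hD : ∀ V ∈ D, ∀ V' ∈ D, ∀ k, |((V k - V' k : ℤ) : ℝ)| ≤ m) :
    ∑ V ∈ D, ∏ j, Real.cos (2 * ∑ k, V k * w k j) ^ 2 ≤ (4 * (1 + 2 / √σ)) ^ Fintype.card K := by
  rcases D.eq_empty_or_nonempty with rfl | hne
  · rw [Finset.sum_empty]
    positivity
  obtain ⟨V₀, hV₀⟩ := hσ.exists_prod_cos_sq_le hw hm hne hD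
  have hsq : (√σ / 2) ^ 2 = σ / 4 := by
    rw [div_pow, Real.sq_sqrt hσ0.le]
    norm_num
  calc ∑ V ∈ D, ∏ j, Real.cos (2 * ∑ k, V k * w k j) ^ 2
    _ ≤ ∑ V ∈ D, ∏ k, Real.exp (-((√σ / 2) ^ 2 * ((V k - V₀ k : ℤ) : ℝ) ^ 2)) := by
        refine Finset.sum_le_sum fun V hV => ?_
        rw [← Real.exp_sum, Finset.sum_neg_distrib, ← Finset.mul_sum, hsq]
        exact hV₀ V hV
    _ ≤ ∑ V ∈ Fintype.piFinset S,
          ∏ k, Real.exp (-((√σ / 2) ^ 2 * ((V k - V₀ k : ℤ) : ℝ) ^ 2)) :=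
        Finset.sum_le_sum_of_subset_of_nonneg hDS fun _ _ _ => by positivity
    _ = ∏ k, ∑ v ∈ S k, Real.exp (-((√σ / 2) ^ 2 * ((v - V₀ k : ℤ) : ℝ) ^ 2)) := by
        rw [Finset.prod_univ_sum]
    _ ≤ ∏ _k : K, (4 * (1 + 1 / (√σ / 2))) :=
        Finset.prod_le_prod (fun _ _ => Finset.sum_nonneg fun _ _ => by positivity)
          fun k _ => sum_gaussian_le (by positivity) _ _
    _ = (4 * (1 + 2 / √σ)) ^ Fintype.card K := by
        rw [Finset.prod_const, Finset.card_univ, one_div_div]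

lemma mul_natAbs_tdiv_le (ℓ : ℕ) (v : ℤ) : ℓ * (v.tdiv ℓ).natAbs ≤ v.natAbs := by
  rw [Int.natAbs_tdiv, Int.natAbs_natCast]
  exact Nat.mul_div_le _ _

lemma abs_sub_le_of_tdiv_eq {ℓ : ℕ} (hℓ : 0 < ℓ) {v v' : ℤ} (h : v.tdiv ℓ = v'.tdiv ℓ) :
    |v - v'| ≤ 2 * ℓ := by
  have hv := Int.mul_tdiv_add_tmod v ℓ
  have hv' := Int.mul_tdiv_add_tmod v' ℓ
  have hmod : ∀ x : ℤ, |x.tmod ℓ| ≤ ℓ := fun x => by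
    rw [Int.abs_eq_natAbs, Int.natAbs_tmod, Int.natAbs_natCast]
    exact_mod_cast (Nat.mod_lt _ hℓ).le
  rw [← hv, ← hv', h, add_sub_add_left_eq_sub]
  exact (abs_sub _ _).trans (by linarith [hmod v, hmod v'])

lemma sum_binomWeight_multiples_le (h : ℕ) {ℓ : ℕ} (hℓ : 0 < ℓ) (S : Finset ℤ) :
    ∑ q ∈ S, binomWeight h (ℓ * q.natAbs) ≤ 2 * (1 / √(2 * h + 1) + 1 / ℓ) := by
  have hrange : ∀ N, ∑ q ∈ Finset.range N, binomWeight h (ℓ * q) ≤ 1 / √(2 * h + 1) + 1 / ℓ :=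
    fun N => (sum_multiples_le_of_antitone (binomWeight_antitone h) (binomWeight_nonneg h) hℓ
      N).trans (by
        gcongr
        · exact binomWeight_zero_le h
        · exact sum_range_binomWeight_le_one h _)
  simpa only [sub_zero] using
    sum_natAbs_sub_le (F := fun u => binomWeight h (ℓ * u)) (fun _ => binomWeight_nonneg h _)
      hrange S 0

/-- The lattice is cut into boxes of side about `ℓ`: the weights vary little on each box, and the
cosines concentrate near one of its points. -/
lemma RowCoercive.sum_binomWeight_mul_prod_cos_sq_le {σ τ : ℝ} {w : K → J → ℝ}
    (hσ : RowCoercive σ w) (hσ0 : 0 < σ) (hw : ∀ k j, |w k j| ≤ τ) {ℓ : ℕ}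
    (hℓ : 0 < ℓ) (hm : 2 * (Fintype.card K * (2 * ℓ * τ)) ≤ 1) (h : ℕ) :
    ∑ V ∈ Fintype.piFinset fun _ : K => Finset.Icc (-(h : ℤ)) h,
        (∏ k, binomWeight h (V k).natAbs) * ∏ j, Real.cos (2 * ∑ k, V k * w k j) ^ 2
      ≤ (2 * (1 / √(2 * h + 1) + 1 / ℓ) * (4 * (1 + 2 / √σ))) ^ Fintype.card K := by
  set P := Fintype.piFinset fun _ : K => Finset.Icc (-(h : ℤ)) h with hP
  let box (V : K → ℤ) : K → ℤ := fun k => (V k).tdiv ℓ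
  have hmaps : ∀ V ∈ P, box V ∈ P := fun V hV => by
    simp only [hP, Fintype.mem_piFinset, Finset.mem_Icc] at hV ⊢
    intro k
    have := Int.natAbs_tdiv_le_natAbs (V k) ℓ
    grind
  have hbox : ∀ q ∈ P, ∑ V ∈ P with box V = q,
      (∏ k, binomWeight h (V k).natAbs) * ∏ j, Real.cos (2 * ∑ k, V k * w k j) ^ 2
      ≤ (∏ k, binomWeight h (ℓ * (q k).natAbs)) * (4 * (1 + 2 / √σ)) ^ Fintype.card K := by
    intro q _
    have hbox_eq : ∀ V ∈ P.filter (box · = q), ∀ k, (V k).tdiv ℓ = q k := fun V hV =>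
      congrFun (Finset.mem_filter.1 hV).2
    calc _ ≤ ∑ V ∈ P with box V = q, (∏ k, binomWeight h (ℓ * (q k).natAbs)) *
            ∏ j, Real.cos (2 * ∑ k, V k * w k j) ^ 2 := by
          gcongr with V hV k
          · exact fun _ _ => binomWeight_nonneg h _
          · exact binomWeight_antitone h (hbox_eq V hV k ▸ mul_natAbs_tdiv_le ℓ (V k))
      _ ≤ _ := by
          rw [← Finset.mul_sum]
          refine mul_le_mul_of_nonneg_left (hσ.sum_box_prod_cos_sq_le hσ0 hw hm
            (Finset.filter_subset _ _) fun V hV V' hV' k => ?_)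
            (Finset.prod_nonneg fun _ _ => binomWeight_nonneg h _)
          exact_mod_cast abs_sub_le_of_tdiv_eq hℓ ((hbox_eq V hV k).trans (hbox_eq V' hV' k).symm)
  rw [← Finset.sum_fiberwise_of_maps_to hmaps]
  refine (Finset.sum_le_sum hbox).trans ?_
  rw [← Finset.sum_mul, hP, ← Finset.prod_univ_sum (fun _ => Finset.Icc (-(h : ℤ)) h)
    (fun _ q => binomWeight h (ℓ * q.natAbs)), Finset.prod_const, Finset.card_univ,
    ← mul_pow]
  gcongr
  · have := Finset.sum_nonneg fun q (_ : q ∈ Finset.Icc (-(h : ℤ)) h) =>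
      binomWeight_nonneg h (ℓ * q.natAbs)
    positivity
  · exact sum_binomWeight_multiples_le h hℓ _

end BoxSums

section QuadraticPolynomials

open scoped BigOperators

lemma mul_quadraticPoly {n : ℕ} (τ : ℝ) (a : Fin n → Fin n → ℝ) (b : Fin n → ℝ) (c : ℝ)
    (x : Fin n → ℝ) :
    τ * quadraticPoly a b c x
      = quadraticPoly (fun i j => τ * a i j) (fun i => τ * b i) (τ * c) x := by
  simp only [quadraticPoly, mul_add, Finset.mul_sum, mul_assoc]

lemma coeffMatrix_const_mul {n : ℕ} (τ : ℝ) (a : Fin n → Fin n → ℝ) (i j : Fin n) :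
    coeffMatrix (fun i j => τ * a i j) i j = τ * coeffMatrix a i j := by
  simp only [coeffMatrix, Matrix.of_apply, mul_ite]

lemma abs_coeffMatrix_le {n : ℕ} {a : Fin n → Fin n → ℝ} {τ : ℝ}
    (ha : ∀ i j, i ≤ j → |a i j| ≤ τ) (i j : Fin n) : |coeffMatrix a i j| ≤ τ := by
  simp only [coeffMatrix, Matrix.of_apply]
  split_ifs with hij
  · exact ha i j hij
  · exact ha j i (le_of_not_ge hij)

lemma sum_sum_eq_blocks {ι R : Type*} [Fintype ι] [AddCommMonoid R] (p : ι → Prop)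
    [DecidablePred p] (F : ι → ι → R) :
    ∑ i, ∑ j, F i j = (∑ i : {i // p i}, ∑ j : {j // p j}, F i j)
      + (∑ i : {i // ¬p i}, ∑ j : {j // ¬p j}, F i j)
      + ∑ i : {i // p i}, ∑ j : {j // ¬p j}, (F i j + F j i) := by
  have hblocks : ∀ G : ι → R, ∑ i, G i = (∑ i : {i // p i}, G i) + ∑ i : {i // ¬p i}, G i :=
    fun G => (Fintype.sum_subtype_add_sum_subtype p G).symm
  rw [hblocks fun i => ∑ j, F i j]
  simp only [fun i => hblocks (F i), Finset.sum_add_distrib]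
  rw [Finset.sum_comm (s := (Finset.univ : Finset {i // ¬p i}))
    (t := (Finset.univ : Finset {i // p i}))]
  abel

lemma sum_Ici_eq_blocks {n : ℕ} (a : Fin n → Fin n → ℝ) (p : Fin n → Prop) [DecidablePred p]
    (x : Fin n → ℝ) :
    ∑ i, ∑ j ∈ Finset.Ici i, a i j * x i * x j
      = (∑ i : {i // p i}, ∑ j : {j // p j}, (if i.1 ≤ j.1 then a i j else 0) * x i * x j)
        + (∑ i : {i // ¬p i}, ∑ j : {j // ¬p j}, (if i.1 ≤ j.1 then a i j else 0) * x i * x j)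
        + ∑ i : {i // p i}, x i * ∑ j : {j // ¬p j}, coeffMatrix a i j * x j := by
  have hfull : ∑ i, ∑ j ∈ Finset.Ici i, a i j * x i * x j
      = ∑ i, ∑ j, (if i ≤ j then a i j else 0) * x i * x j := by
    refine Finset.sum_congr rfl fun i _ => ?_
    simp only [ite_mul, zero_mul, ← Finset.sum_filter, Finset.filter_le_eq_Ici]
  have hcross : ∀ (i : {i // p i}) (j : {j // ¬p j}),
      (if i.1 ≤ j.1 then a i j else 0) * x i * x j + (if j.1 ≤ i.1 then a j i else 0) * x j * x i
        = x i * (coeffMatrix a i j * x j) := by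
    intro i j
    have hne : i.1 ≠ j.1 := fun h => j.2 (h ▸ i.2)
    rcases hne.lt_or_gt with hlt | hlt <;>
    · simp only [coeffMatrix, Matrix.of_apply, hlt.le, hlt.not_ge, if_true, if_false]
      ring
  simp only [hfull, sum_sum_eq_blocks p, hcross, Finset.mul_sum]

/-- The polynomial is bilinear in two complementary blocks of variables, up to terms that depend on
one of the blocks only. -/
lemma exists_quadraticPoly_eq_add_bilinear {n : ℕ} (a : Fin n → Fin n → ℝ) (b : Fin n → ℝ) (c : ℝ)
    (p : Fin n → Prop) [DecidablePred p] :
    ∃ (A : ({i // p i} → ℝ) → ℝ) (B : ({i // ¬p i} → ℝ) → ℝ), ∀ x : Fin n → ℝ,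
      quadraticPoly a b c x = A (fun i => x i) + B (fun i => x i)
        + ∑ i : {i // p i}, x i * ∑ j : {j // ¬p j}, coeffMatrix a i j * x j := by
  refine ⟨fun z => (∑ i : {i // p i}, ∑ j : {j // p j},
      (if i.1 ≤ j.1 then a i j else 0) * z i * z j) + ∑ i : {i // p i}, b i * z i + c,
    fun y => (∑ i : {i // ¬p i}, ∑ j : {j // ¬p j},
      (if i.1 ≤ j.1 then a i j else 0) * y i * y j) + ∑ i : {i // ¬p i}, b i * y i, fun x => ?_⟩
  rw [quadraticPoly, sum_Ici_eq_blocks a p,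
    ← Fintype.sum_subtype_add_sum_subtype p fun i => b i * x i]
  ring

lemma sq_norm_expect_cexp_quadraticPoly_le {n : ℕ} (a : Fin n → Fin n → ℝ) (b : Fin n → ℝ) (c : ℝ)
    (U : Finset (Fin n)) :
    ‖𝔼 ε : Fin n → Bool,
        Complex.exp ((quadraticPoly a b c (fun i => boolSign (ε i)) : ℝ) * Complex.I)‖ ^ 2
      ≤ 𝔼 y : {j // j ∉ U} → Bool, 𝔼 y' : {j // j ∉ U} → Bool, ∏ i ∈ U,
          |Real.cos (∑ j : {j // j ∉ U},
            coeffMatrix a i j * (boolSign (y j) - boolSign (y' j)))| := by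
  obtain ⟨A, B, hAB⟩ := exists_quadraticPoly_eq_add_bilinear a b c (· ∈ U)
  simp only [Finset.prod_subtype U fun _ => Iff.rfl]
  refine le_trans (le_of_eq ?_) (sq_norm_expect_cexp_bilinear_le
    (fun z => A fun i => boolSign (z i)) (fun y => B fun j => boolSign (y j))
    fun (i : {i // i ∈ U}) (j : {j // j ∉ U}) => coeffMatrix a i j)
  rw [← Finset.expect_product', Finset.univ_product_univ,
    Fintype.expect_equiv (Equiv.piEquivPiSubtypeProd (· ∈ U) fun _ => Bool) _ _ fun ε => ?_]
  rw [hAB]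
  congr!

lemma prod_le_expect_pow {ι : Type*} {s : Finset ι} (hs : s.Nonempty) {G : ι → ℝ}
    (hG : ∀ i ∈ s, 0 ≤ G i) : ∏ i ∈ s, G i ≤ 𝔼 i ∈ s, G i ^ s.card := by
  have hamgm := Real.geom_mean_le_arith_mean_weighted s (fun _ => (s.card : ℝ)⁻¹)
    (fun i => G i ^ s.card) (fun _ _ => by positivity)
    (by simp [hs.card_ne_zero]) fun i hi => pow_nonneg (hG i hi) _
  rwa [Finset.prod_congr rfl fun i hi =>
    Real.pow_rpow_inv_natCast (hG i hi) hs.card_ne_zero, ← Finset.mul_sum, ← div_eq_inv_mul,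
    ← Finset.expect_eq_sum_div_card] at hamgm

/-- The indices that occur in the tuples of a family. -/
def tupleSupport {κ ι : Type*} [Fintype κ] [DecidableEq ι] (T : Finset (κ → ι)) : Finset ι :=
  T.biUnion fun t => Finset.univ.image t

variable {κ ι : Type*} [Fintype κ] [DecidableEq ι]

lemma card_tupleSupport_le (T : Finset (κ → ι)) :
    (tupleSupport T).card ≤ T.card * Fintype.card κ :=
  Finset.card_biUnion_le_card_mul _ _ _ fun _ _ => Finset.card_image_le

lemma prod_tupleSupport {T : Finset (κ → ι)}
    (hdisj : (T : Set (κ → ι)).PairwiseDisjoint fun t => Set.range t)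
    (hinj : ∀ t ∈ T, Function.Injective t) {R : Type*} [CommMonoid R] (G : ι → R) :
    ∏ i ∈ tupleSupport T, G i = ∏ t ∈ T, ∏ k, G (t k) := by
  rw [tupleSupport, Finset.prod_biUnion fun t ht t' ht' hne => ?_]
  · exact Finset.prod_congr rfl fun t ht => Finset.prod_image (hinj t ht).injOn
  · rw [Function.onFun, ← Finset.disjoint_coe]
    simpa only [Finset.coe_image, Finset.coe_univ, Set.image_univ] using hdisj ht ht' hne

lemma prod_tupleSupport_le_expect {T : Finset (κ → ι)} (hT : T.Nonempty)
    (hdisj : (T : Set (κ → ι)).PairwiseDisjoint fun t => Set.range t)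
    (hinj : ∀ t ∈ T, Function.Injective t) {G : ι → ℝ} (hG : ∀ i, 0 ≤ G i) :
    ∏ i ∈ tupleSupport T, G i ≤ 𝔼 t ∈ T, ∏ k, G (t k) ^ T.card := by
  rw [prod_tupleSupport hdisj hinj]
  simp only [Finset.prod_pow]
  exact prod_le_expect_pow hT fun t _ => Finset.prod_nonneg fun k _ => hG _

lemma RowCoercive.linearIndependent {K J : Type*} [Fintype K] [Fintype J] {σ : ℝ}
    {w : K → J → ℝ} (hw : RowCoercive σ w) (hσ : 0 < σ) : LinearIndependent ℝ w := by
  rw [Fintype.linearIndependent_iff]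
  intro V hV
  have hzero : ∀ j, ∑ k, V k * w k j = 0 := fun j => by
    simpa only [Finset.sum_apply, Pi.smul_apply, smul_eq_mul, Pi.zero_apply] using congrFun hV j
  have hsq : ∑ k, V k ^ 2 ≤ 0 := by
    refine nonpos_of_mul_nonpos_right ((hw V).trans_eq ?_) hσ
    simp [hzero]
  intro k
  have := (Finset.sum_eq_zero_iff_of_nonneg fun k _ => sq_nonneg (V k)).1
    (le_antisymm hsq (Finset.sum_nonneg fun _ _ => sq_nonneg _)) k (Finset.mem_univ k)
  exact pow_eq_zero_iff two_ne_zero |>.1 this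

lemma expect_expect_prod_tupleSupport_le {J : Type*} [Fintype J] [DecidableEq J] {h : ℕ}
    {T : Finset (κ → ι)} (hT : T.Nonempty) (hcard : T.card = 2 * h)
    (hdisj : (T : Set (κ → ι)).PairwiseDisjoint fun t => Set.range t)
    (hinj : ∀ t ∈ T, Function.Injective t) (m : ι → J → ℝ) :
    𝔼 y : J → Bool, 𝔼 y' : J → Bool, ∏ i ∈ tupleSupport T,
        |Real.cos (∑ j, m i j * (boolSign (y j) - boolSign (y' j)))|
      ≤ 𝔼 t ∈ T, 𝔼 y : J → Bool, 𝔼 y' : J → Bool, ∏ k,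
          Real.cos (∑ j, m (t k) j * (boolSign (y j) - boolSign (y' j))) ^ (2 * h) := by
  simp only [Finset.expect_comm (s := T)]
  refine Finset.expect_le_expect fun y _ => Finset.expect_le_expect fun y' _ => ?_
  have hamgm := prod_tupleSupport_le_expect hT hdisj hinj
    (G := fun i => |Real.cos (∑ j, m i j * (boolSign (y j) - boolSign (y' j)))|)
    fun i => abs_nonneg _
  simpa only [hcard, (even_two_mul h).pow_abs] using hamgm

lemma sq_norm_expect_cexp_quadraticPoly_le_of_tuples {n r h : ℕ} (hh : 0 < h)
    (a : Fin n → Fin n → ℝ) (b : Fin n → ℝ) (c : ℝ) {T : Finset (Fin r → Fin n)}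
    (hcard : T.card = 2 * h)
    (hdisj : (T : Set (Fin r → Fin n)).PairwiseDisjoint fun t => Set.range t)
    {σ τ : ℝ} (hσ0 : 0 < σ) (hτ : ∀ i j, |coeffMatrix a i j| ≤ τ)
    (hσ : ∀ t ∈ T, RowCoercive σ fun k (j : {j // j ∉ tupleSupport T}) => coeffMatrix a (t k) j)
    {ℓ : ℕ} (hℓ : 0 < ℓ) (hm : 2 * (r * (2 * ℓ * τ)) ≤ 1) :
    ‖𝔼 ε : Fin n → Bool,
        Complex.exp ((quadraticPoly a b c (fun i => boolSign (ε i)) : ℝ) * Complex.I)‖ ^ 2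
      ≤ (2 * (1 / √(2 * h + 1) + 1 / ℓ) * (4 * (1 + 2 / √σ))) ^ r := by
  have hT : T.Nonempty := Finset.card_pos.1 (by omega)
  have hinj : ∀ t ∈ T, Function.Injective t := fun t ht k k' hkk' =>
    ((hσ t ht).linearIndependent hσ0).injective (funext fun j => by simp only [hkk'])
  refine (sq_norm_expect_cexp_quadraticPoly_le a b c (tupleSupport T)).trans
    ((expect_expect_prod_tupleSupport_le hT hcard hdisj hinj
      fun i (j : {j // j ∉ tupleSupport T}) => coeffMatrix a i j).trans
    (Finset.expect_le hT fun t ht => ?_))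
  rw [expect_expect_prod_cos_pow h fun k (j : {j // j ∉ tupleSupport T}) => coeffMatrix a (t k) j]
  have hbound := (hσ t ht).sum_binomWeight_mul_prod_cos_sq_le hσ0 (fun k j => hτ _ _) hℓ
    (by rwa [Fintype.card_fin]) h
  rwa [Fintype.card_fin] at hbound

end QuadraticPolynomials

section Nondegenerate

variable {r n : ℕ} {δ : ℝ} {M : Matrix (Fin r) (Fin n) ℝ}

lemma IsNonDegenerate.le_card (hM : IsNonDegenerate δ M) (hδ : 0 ≤ δ) {V : Fin r → ℝ}
    (hV : V ≠ 0) :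
    δ * n ≤ ((Finset.univ.filter fun j =>
      δ ^ 2 * ∑ k, V k ^ 2 ≤ (∑ k, V k * M k j) ^ 2).card : ℝ) := by
  set v : EuclideanSpace ℝ (Fin r) := WithLp.toLp 2 V
  have hnorm : 0 < ‖v‖ := norm_pos_iff.2 ((WithLp.toLp_eq_zero 2).not.2 hV)
  have hunit := hM (‖v‖⁻¹ • v)
    (by rw [norm_smul, norm_inv, norm_norm, inv_mul_cancel₀ hnorm.ne'])
  refine hunit.trans (Nat.cast_le.2 (Finset.card_le_card fun j hj => ?_))
  rw [Finset.mem_filter_univ] at hj ⊢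
  have hinner : inner ℝ (WithLp.toLp 2 (M.col j)) (‖v‖⁻¹ • v) = (∑ k, V k * M k j) / ‖v‖ := by
    rw [inner_smul_right, inv_mul_eq_div]
    rfl
  rw [hinner, abs_div, abs_norm, le_div_iff₀ hnorm] at hj
  calc δ ^ 2 * ∑ k, V k ^ 2
    _ = (δ * ‖v‖) ^ 2 := by rw [mul_pow, EuclideanSpace.real_norm_sq_eq]
    _ ≤ |∑ k, V k * M k j| ^ 2 := by gcongr
    _ = (∑ k, V k * M k j) ^ 2 := sq_abs _

lemma IsNonDegenerate.rowCoercive_compl (hM : IsNonDegenerate δ M) (hδ : 0 ≤ δ)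
    {U : Finset (Fin n)} (hU : (U.card : ℝ) ≤ δ * n / 2) :
    RowCoercive (δ ^ 3 * n / 2) fun k (j : {j // j ∉ U}) => M k j := by
  intro V
  rcases eq_or_ne V 0 with rfl | hV
  · simp
  set G := Finset.univ.filter fun j => δ ^ 2 * ∑ k, V k ^ 2 ≤ (∑ k, V k * M k j) ^ 2
  have hcard : δ * n / 2 ≤ ((G \ U).card : ℝ) := by
    have hsdiff : (G.card : ℝ) ≤ (G \ U).card + U.card := by
      exact_mod_cast Finset.card_le_card_sdiff_add_card
    linarith [hM.le_card hδ hV]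
  calc δ ^ 3 * n / 2 * ∑ k, V k ^ 2
    _ = δ * n / 2 * (δ ^ 2 * ∑ k, V k ^ 2) := by ring
    _ ≤ (G \ U).card * (δ ^ 2 * ∑ k, V k ^ 2) := by gcongr
    _ ≤ ∑ j ∈ G \ U, (∑ k, V k * M k j) ^ 2 := by
        rw [← nsmul_eq_mul]
        refine Finset.card_nsmul_le_sum _ _ _ fun j hj => ?_
        exact (Finset.mem_filter_univ j).1 (Finset.mem_sdiff.1 hj).1
    _ ≤ ∑ j ∈ Uᶜ, (∑ k, V k * M k j) ^ 2 :=
        Finset.sum_le_sum_of_subset_of_nonneg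
          (fun j hj => Finset.mem_compl.2 (Finset.mem_sdiff.1 hj).2) fun _ _ _ => sq_nonneg _
    _ = ∑ j : {j // j ∉ U}, (∑ k, V k * M k j) ^ 2 :=
        Finset.sum_subtype _ (fun _ => Finset.mem_compl) _

lemma IsNonDegenerate.le_of_pos (hM : IsNonDegenerate δ M) (hδ : 0 < δ) (hn : 0 < n) :
    r ≤ n := by
  have hcoercive := hM.rowCoercive_compl hδ.le (U := ∅)
    (by rw [Finset.card_empty, Nat.cast_zero]; positivity)
  simpa using (hcoercive.linearIndependent (by positivity)).fintype_card_le_finrank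

end Nondegenerate

section CharacteristicFunction

open scoped BigOperators

lemma one_div_natFloor_le {y : ℝ} (hy : 1 ≤ y) : 1 / (⌊y⌋₊ : ℝ) ≤ 2 / y := by
  have hfloor : (1 : ℝ) ≤ ⌊y⌋₊ := by exact_mod_cast Nat.floor_pos.2 hy
  rw [div_le_div_iff₀ (by positivity) (by positivity)]
  linarith [Nat.lt_floor_add_one y]

lemma add_mul_one_add_le {c₁ c₂ c₃ s τ : ℝ} (h₁ : 0 ≤ c₁) (h₂ : 0 ≤ c₂) (h₃ : 0 ≤ c₃) (hs : 0 < s)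
    (hτ : 0 < τ) :
    (c₁ / s + c₂ * τ) * (1 + c₃ / (s * τ))
      ≤ 2 * (c₁ + c₂) * (1 + c₃) * (1 / (s ^ 2 * τ) + τ) := by
  have hsum : c₁ / s + c₂ * τ ≤ (c₁ + c₂) * (1 / s + τ) := by
    have : 0 ≤ c₁ * τ + c₂ * (1 / s) := by positivity
    linarith [div_eq_mul_one_div c₁ s]
  have hone : 1 + c₃ / (s * τ) ≤ (1 + c₃) * (1 + 1 / (s * τ)) := by
    have : 0 ≤ c₃ + 1 / (s * τ) := by positivity
    linarith [div_eq_mul_one_div c₃ (s * τ)]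
  calc (c₁ / s + c₂ * τ) * (1 + c₃ / (s * τ))
    _ ≤ (c₁ + c₂) * (1 / s + τ) * ((1 + c₃) * (1 + 1 / (s * τ))) := by gcongr
    _ = (c₁ + c₂) * (1 + c₃) * ((1 / s + τ) ^ 2 / τ) := by
        field_simp
        ring
    _ ≤ (c₁ + c₂) * (1 + c₃) * (2 * ((1 / s) ^ 2 + τ ^ 2) / τ) := by
        gcongr
        exact add_sq_le
    _ = 2 * (c₁ + c₂) * (1 + c₃) * (1 / (s ^ 2 * τ) + τ) := by field_simp

/-- The constant `K` in the bound `(K * (1 / (n * τ) + τ)) ^ (r / 2)` for the characteristic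
function at `τ`. The first summand serves large `n` and small `τ`; together with the second one it
makes the bound trivial otherwise. -/
noncomputable def decayConst (r : ℕ) (δ : ℝ) : ℝ :=
  16 * (1 / √(δ / (4 * r)) + 8 * r) * (1 + 2 / √(δ ^ 3 / 2)) + 4 * r / δ

variable {r n : ℕ} {δ τ : ℝ}

lemma box_bound_le_decayConst_mul (hr : 0 < r) (hδ : 0 < δ) (hn : 4 * r ≤ δ * n) (hτ : 0 < τ)
    (hrτ : 4 * r * τ ≤ 1) :
    2 * (1 / √(2 * ⌊δ / (4 * r) * n⌋₊ + 1) + 1 / (⌊1 / (4 * r * τ)⌋₊ : ℝ))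
        * (4 * (1 + 2 / √(τ ^ 2 * (δ ^ 3 * n / 2))))
      ≤ decayConst r δ * (1 / (n * τ) + τ) := by
  have : (0 : ℝ) < r := by exact_mod_cast hr
  have hn' : (0 : ℝ) < n := pos_of_mul_pos_right (lt_of_lt_of_le (by positivity) hn) hδ.le
  have hsqrt_h : 1 / √(2 * ⌊δ / (4 * r) * n⌋₊ + 1) ≤ 1 / √(δ / (4 * r)) / √n := by
    rw [div_div, ← Real.sqrt_mul (by positivity)]
    gcongr
    linarith [Nat.lt_floor_add_one (δ / (4 * r) * n),
      (Nat.cast_nonneg _ : (0 : ℝ) ≤ ⌊δ / (4 * r) * n⌋₊)]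
  have hfloor : 1 / (⌊1 / (4 * r * τ)⌋₊ : ℝ) ≤ 8 * r * τ := by
    refine (one_div_natFloor_le (by rwa [le_div_iff₀ (by positivity), one_mul])).trans_eq ?_
    field_simp
    norm_num
  have hsqrt_σ : √(τ ^ 2 * (δ ^ 3 * n / 2)) = √(δ ^ 3 / 2) * (√n * τ) := by
    rw [Real.sqrt_mul (sq_nonneg τ), Real.sqrt_sq hτ.le, mul_div_right_comm,
      Real.sqrt_mul (by positivity)]
    ring
  calc _ ≤ 8 * ((1 / √(δ / (4 * r)) / √n + 8 * r * τ)
          * (1 + 2 / √(δ ^ 3 / 2) / (√n * τ))) := by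
        rw [hsqrt_σ, div_div (2 : ℝ)]
        linarith [mul_le_mul_of_nonneg_right (add_le_add hsqrt_h hfloor)
          (by positivity : 0 ≤ 1 + 2 / (√(δ ^ 3 / 2) * (√n * τ)))]
    _ ≤ 8 * (2 * (1 / √(δ / (4 * r)) + 8 * r) * (1 + 2 / √(δ ^ 3 / 2))
          * (1 / (√n ^ 2 * τ) + τ)) :=
        mul_le_mul_of_nonneg_left (add_mul_one_add_le (by positivity) (by positivity)
          (by positivity) (by positivity) hτ) (by norm_num)
    _ ≤ decayConst r δ * (1 / (n * τ) + τ) := by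
        rw [Real.sq_sqrt hn'.le, decayConst]
        have : 0 ≤ 4 * r / δ * (1 / (n * τ) + τ) := by positivity
        linarith

lemma one_le_decayConst (hr : 0 < r) (hδ : 0 < δ) : 1 ≤ decayConst r δ := by
  have hr' : (1 : ℝ) ≤ r := by exact_mod_cast hr
  have h₁ : 1 ≤ 1 / √(δ / (4 * r)) + 8 * r := by
    have : 0 ≤ 1 / √(δ / (4 * r)) := by positivity
    linarith
  have h₂ : 1 ≤ 1 + 2 / √(δ ^ 3 / 2) := le_add_of_nonneg_right (by positivity)
  have h₃ : 0 ≤ 4 * r / δ := by positivity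
  rw [decayConst]
  nlinarith

lemma one_le_decayConst_mul (hr : 0 < r) (hδ : 0 < δ) (hn : 0 < n) (hτ : 0 < τ)
    (hsmall : ¬(4 * r ≤ δ * n ∧ 4 * r * τ ≤ 1)) : 1 ≤ decayConst r δ * (1 / (n * τ) + τ) := by
  have hr' : (0 : ℝ) < r := by exact_mod_cast hr
  have : (0 : ℝ) < n := by exact_mod_cast hn
  have hconst : 4 * r + 4 * r / δ ≤ decayConst r δ := by
    have h₁ : 0 ≤ 1 / √(δ / (4 * r)) := by positivity
    have h₂ : 0 ≤ 2 / √(δ ^ 3 / 2) := by positivity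
    rw [decayConst]
    nlinarith
  calc (1 : ℝ)
    _ ≤ (4 * r + 4 * r / δ) * (1 / (n * τ) + τ) := ?_
    _ ≤ decayConst r δ * (1 / (n * τ) + τ) := by gcongr
  rcases lt_or_ge 1 (4 * r * τ) with hrτ | hrτ
  · have : 0 ≤ 4 * r / δ * (1 / (n * τ) + τ) + 4 * r * (1 / (n * τ)) := by positivity
    linarith
  · have hδn : δ * n < 4 * r := not_le.1 fun h => hsmall ⟨h, hrτ⟩
    have hone : 1 ≤ 4 * r / δ * (1 / (n * τ)) := by
      rw [div_mul_div_comm, mul_one, one_le_div (by positivity)]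
      have hr1 : (1 : ℝ) ≤ r := by exact_mod_cast hr
      nlinarith
    have : 0 ≤ 4 * r * (1 / (n * τ) + τ) + 4 * r / δ * τ := by positivity
    linarith

variable {a : Fin n → Fin n → ℝ} {T : Finset (Fin r → Fin n)}

lemma exists_subset_card_eq_card_tupleSupport_le (hr : 0 < r) (hT : δ * n ≤ T.card) {h : ℕ}
    (hh : 4 * r * h ≤ δ * n) :
    ∃ S ⊆ T, S.card = 2 * h ∧ ((tupleSupport S).card : ℝ) ≤ δ * n / 2 := by
  have hhT : 2 * h ≤ T.card := by
    have hr' : (1 : ℝ) ≤ r := by exact_mod_cast hr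
    have : (2 * h : ℝ) ≤ T.card := by nlinarith
    exact_mod_cast this
  obtain ⟨S, hST, hS⟩ := Finset.exists_subset_card_eq hhT
  refine ⟨S, hST, hS, ?_⟩
  have hsupport : ((tupleSupport S).card : ℝ) ≤ 2 * h * r := by
    have hcard := card_tupleSupport_le S
    rw [hS, Fintype.card_fin] at hcard
    exact_mod_cast hcard
  linarith

lemma sq_norm_expect_cexp_mul_quadraticPoly_le_of_le (hr : 0 < r) (hδ : 0 < δ)
    (ha : ∀ i j, i ≤ j → |a i j| ≤ 1) (b : Fin n → ℝ) (c : ℝ) (hT : δ * n ≤ T.card)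
    (hdisj : (T : Set (Fin r → Fin n)).PairwiseDisjoint fun t => Set.range t)
    (hnd : ∀ t ∈ T, IsNonDegenerate δ ((coeffMatrix a).submatrix t id))
    (hn : 4 * r ≤ δ * n) (hτ : 0 < τ) (hrτ : 4 * r * τ ≤ 1) :
    ‖𝔼 ε : Fin n → Bool,
        Complex.exp ((τ * quadraticPoly a b c (fun i => boolSign (ε i)) : ℝ) * Complex.I)‖ ^ 2
      ≤ (decayConst r δ * (1 / (n * τ) + τ)) ^ r := by
  have : (0 : ℝ) < r := by exact_mod_cast hr
  have hn' : (0 : ℝ) < n := pos_of_mul_pos_right (lt_of_lt_of_le (by positivity) hn) hδ.le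
  set h := ⌊δ / (4 * r) * n⌋₊
  set ℓ := ⌊1 / (4 * r * τ)⌋₊
  have hh : 0 < h := Nat.floor_pos.2 (by rwa [div_mul_eq_mul_div, one_le_div (by positivity)])
  have hℓ : 0 < ℓ := Nat.floor_pos.2 (by rwa [one_le_div (by positivity)])
  have hhr : 4 * r * h ≤ δ * n := by
    have : (h : ℝ) ≤ δ / (4 * r) * n := Nat.floor_le (by positivity)
    rwa [div_mul_eq_mul_div, le_div_iff₀' (by positivity)] at this
  have hℓr : 4 * r * τ * ℓ ≤ 1 := by
    have : (ℓ : ℝ) ≤ 1 / (4 * r * τ) := Nat.floor_le (by positivity)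
    rwa [le_div_iff₀' (by positivity)] at this
  obtain ⟨S, hST, hS, hsupport⟩ := exists_subset_card_eq_card_tupleSupport_le hr hT hhr
  simp only [mul_quadraticPoly]
  refine (sq_norm_expect_cexp_quadraticPoly_le_of_tuples hh _ _ _ hS
    (hdisj.subset (Finset.coe_subset.2 hST)) (σ := τ ^ 2 * (δ ^ 3 * n / 2)) (by positivity)
    (abs_coeffMatrix_le fun i j hij => ?_) (fun t ht => ?_) hℓ (by linarith)).trans
    (pow_le_pow_left₀ (by positivity) (box_bound_le_decayConst_mul hr hδ hn hτ hrτ) r)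
  · rw [abs_mul, abs_of_pos hτ]
    exact mul_le_of_le_one_right hτ.le (ha i j hij)
  · simp only [coeffMatrix_const_mul]
    exact ((hnd t (hST ht)).rowCoercive_compl hδ.le hsupport).const_mul τ

end CharacteristicFunction

section SmallBall

variable {Ω : Type*} [MeasurableSpace Ω] {μ : Measure Ω} {r n : ℕ} {δ : ℝ}
  {a : Fin n → Fin n → ℝ} {T : Finset (Fin r → Fin n)} {ξ : Fin n → Ω → ℝ}

lemma measurable_quadraticPoly (a : Fin n → Fin n → ℝ) (b : Fin n → ℝ) (c : ℝ) :
    Measurable (quadraticPoly a b c) := by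
  unfold quadraticPoly
  fun_prop

lemma IsRademacherVector.aemeasurable_quadraticPoly (hξ : IsRademacherVector ξ μ)
    (a : Fin n → Fin n → ℝ) (b : Fin n → ℝ) (c : ℝ) :
    AEMeasurable (fun ω => quadraticPoly a b c fun i => ξ i ω) μ :=
  (measurable_quadraticPoly a b c).comp_aemeasurable
    (aemeasurable_pi_lambda _ fun i => (hξ.hasLaw i).aemeasurable)

lemma IsRademacherVector.norm_charFun_map_quadraticPoly_le [IsProbabilityMeasure μ]
    (hξ : IsRademacherVector ξ μ) (hr : 0 < r) (hδ : 0 < δ) (hn : 0 < n)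
    (ha : ∀ i j, i ≤ j → |a i j| ≤ 1) (b : Fin n → ℝ) (c : ℝ) (hT : δ * n ≤ T.card)
    (hdisj : (T : Set (Fin r → Fin n)).PairwiseDisjoint fun t => Set.range t)
    (hnd : ∀ t ∈ T, IsNonDegenerate δ ((coeffMatrix a).submatrix t id)) {τ : ℝ} (hτ : 0 < τ) :
    ‖charFun (μ.map fun ω => quadraticPoly a b c fun i => ξ i ω) τ‖
      ≤ (decayConst r δ * (1 / (n * τ) + τ)) ^ (r / 2 : ℝ) := by
  have := Measure.isProbabilityMeasure_map (hξ.aemeasurable_quadraticPoly a b c)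
  by_cases hlarge : 4 * r ≤ δ * n ∧ 4 * r * τ ≤ 1
  · have hsq := sq_norm_expect_cexp_mul_quadraticPoly_le_of_le hr hδ ha b c hT hdisj hnd
      hlarge.1 hτ hlarge.2
    rw [← hξ.charFun_map_eq_expect (measurable_quadraticPoly a b c)] at hsq
    have hbase : 0 ≤ decayConst r δ * (1 / (n * τ) + τ) := by
      have := one_le_decayConst hr hδ
      positivity
    rw [div_eq_mul_one_div (r : ℝ), Real.rpow_mul hbase, Real.rpow_natCast, ← Real.sqrt_eq_rpow]
    exact Real.le_sqrt_of_sq_le hsq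
  · exact (norm_charFun_le_one τ).trans
      (Real.one_le_rpow (one_le_decayConst_mul hr hδ hn hτ hlarge) (by positivity))

lemma rpow_div_self_eq {n r : ℝ} (hn : 0 < n) :
    n ^ (2 / (r + 2)) / n = 1 / n ^ (1 - 2 / (r + 2)) := by
  rw [Real.rpow_sub hn, Real.rpow_one, one_div_div]

lemma rpow_rpow_neg_half_eq {n r : ℝ} (hn : 0 < n) (hr : 0 < r) :
    (n ^ (2 / (r + 2))) ^ (-(r / 2)) = 1 / n ^ (1 - 2 / (r + 2)) := by
  rw [← Real.rpow_mul hn.le, one_div, ← Real.rpow_neg hn.le]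
  congr 1
  field_simp
  ring

lemma one_le_log_of_three_le {x : ℝ} (hx : 3 ≤ x) : 1 ≤ Real.log x := by
  rw [Real.le_log_iff_exp_le (by linarith)]
  linarith [Real.exp_one_lt_d9]

lemma rpow_div_add_rpow_neg_le {n r : ℝ} (hn : 3 ≤ n) (hr : 0 < r) :
    n ^ (2 / (r + 2)) / n + (n ^ (2 / (r + 2))) ^ (-(r / 2))
      ≤ 2 * (Real.log n ^ (r / 2) / n ^ (1 - 2 / (r + 2))) := by
  have hn' : 0 < n := by linarith
  rw [rpow_div_self_eq hn', rpow_rpow_neg_half_eq hn' hr, ← two_mul]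
  gcongr
  exact Real.one_le_rpow (one_le_log_of_three_le hn) (by positivity)

theorem lemma3p2_general (r : ℕ) (hr : 3 ≤ r) (δ : ℝ) (hδ : 0 < δ) :
    ∃ C : ℝ, 0 < C ∧
      ∀ (n : ℕ), 1 ≤ n →
      ∀ (a : Fin n → Fin n → ℝ) (b : Fin n → ℝ) (c : ℝ),
      (∀ i j, i ≤ j → |a i j| ≤ 1) →
      ∀ T : Finset (Fin r → Fin n),
      δ * n ≤ (T.card : ℝ) →
      (T : Set (Fin r → Fin n)).PairwiseDisjoint (fun t => Set.range t) →
      (∀ t ∈ T, IsNonDegenerate δ ((coeffMatrix a).submatrix t id)) →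
      ∀ (Ω : Type*) [MeasurableSpace Ω] (μ : Measure Ω) [IsProbabilityMeasure μ]
        (ξ : Fin n → Ω → ℝ), IsRademacherVector ξ μ →
      ∀ x s : ℝ, 0 < s →
      μ.real {ω | |quadraticPoly a b c (fun i => ξ i ω) - x| ≤ s}
        ≤ C * (s / n + s ^ (-(r / 2 : ℝ))) := by
  have hr3 : (3 : ℝ) ≤ r := by exact_mod_cast hr
  have hp : (0 : ℝ) < r / 2 - 1 := by linarith
  have hK := one_le_decayConst (by omega : 0 < r) hδ
  refine ⟨4 * (4 * decayConst r δ) ^ (r / 2 : ℝ) * (1 / (r / 2 - 1) + 1), by positivity, ?_⟩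
  intro n hn a b c ha T hT hdisj hnd Ω _ μ _ ξ hξ x s hs
  have hf := hξ.aemeasurable_quadraticPoly a b c
  have := Measure.isProbabilityMeasure_map hf
  have hball : MeasurableSet {y : ℝ | |y - x| ≤ s} :=
    measurableSet_le (by fun_prop) measurable_const
  exact (map_measureReal_apply_of_aemeasurable hf hball).symm.trans_le
    (measureReal_abs_sub_le_le_of_norm_charFun_le _ (by linarith) (by exact_mod_cast hn) hK
      (fun τ hτ => hξ.norm_charFun_map_quadraticPoly_le (by omega) hδ hn ha b c hT hdisj hnd hτ)
      x hs)

end SmallBall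

theorem lemma3p2 (r : ℕ) (hr : 3 ≤ r) (δ : ℝ) (hδ : 0 < δ) :
    ∃ C : ℝ, 0 < C ∧
      ∀ (n : ℕ), 1 ≤ n →
      ∀ (a : Fin n → Fin n → ℝ) (b : Fin n → ℝ) (c : ℝ),
      (∀ i j, i ≤ j → |a i j| ≤ 1) →
      ∀ T : Finset (Fin r → Fin n),
      δ * n ≤ (T.card : ℝ) →
      (T : Set (Fin r → Fin n)).PairwiseDisjoint (fun t => Set.range t) →
      (∀ t ∈ T, IsNonDegenerate δ ((coeffMatrix a).submatrix t id)) →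
      ∀ (Ω : Type*) [MeasurableSpace Ω] (μ : Measure Ω) [IsProbabilityMeasure μ]
        (ξ : Fin n → Ω → ℝ), IsRademacherVector ξ μ →
      ∀ x : ℝ,
      μ.real {ω | |quadraticPoly a b c (fun i => ξ i ω) - x| ≤ (n : ℝ) ^ (2 / ((r : ℝ) + 2))}
        ≤ C * (Real.log n ^ ((r : ℝ) / 2) / (n : ℝ) ^ (1 - 2 / ((r : ℝ) + 2))) := by
  obtain ⟨C, hC, hbound⟩ := lemma3p2_general r hr δ hδ
  refine ⟨C * 2, by positivity, ?_⟩
  intro n hn a b c ha T hT hdisj hnd Ω _ μ _ ξ hξ x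
  have hn' : (0 : ℝ) < n := by exact_mod_cast hn
  have hcard : (0 : ℝ) < T.card := lt_of_lt_of_le (by positivity) hT
  obtain ⟨t, ht⟩ : T.Nonempty := Finset.card_pos.1 (by exact_mod_cast hcard)
  have hn3 : 3 ≤ n := hr.trans ((hnd t ht).le_of_pos hδ hn)
  rw [mul_assoc]
  exact (hbound n hn a b c ha T hT hdisj hnd Ω μ ξ hξ x _ (Real.rpow_pos_of_pos hn' _)).trans
    (mul_le_mul_of_nonneg_left (rpow_div_add_rpow_neg_le (by exact_mod_cast hn3)
      (by exact_mod_cast (by omega : 0 < r))) hC.le)
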